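/- Let $P$ be a real-valued $\mathcal C^\infty$-smooth function on an open neighbourhood $U$ of $0$ in $\mathbb C$ such that (i) the connected component of $0$ in the zero set $\{z\in U : P(z)=0\}$ is $\{0\}$, and (ii) $P$ vanishes to infinite order at $0$ (all its partial derivatives of all orders $\ge 0$ vanish at $0$). Let $\rho(z_1,z_2)=\mathrm{Re}\,z_1+P(z_2)$ and $M_P=\{(z_1,z_2) : \rho(z_1,z_2)=0\}$, a real hypersurface near the origin of $\mathbb C^2$. Let $H=h_1\,\partial_{z_1}+h_2\,\partial_{z_2}$ be a holomorphic vector field on a neighbourhood of the origin of $\mathbb C^2$, with $H(0)=0$, which is tangent to $M_P$ near $0$ in the sense that $(\mathrm{Re}\,H)\rho=\mathrm{Re}\,(h_1\rho_{z_1}+h_2\rho_{z_2})=0$ at all points of $M_P$ near $0$. Then either $H\equiv 0$ near $0$, or there are a real number $\beta\neq 0$ and a biholomorphism $\varphi$ between neighbourhoods of $0$ in $\mathbb C$, with $\varphi(0)=0$, such that in the coordinates $(w_1,w_2)$ given by $z_1=w_1$, $z_2=\varphi(w_2)$ one has, near the origin, $H=i\beta w_2\,\partial_{w_2}$, and the hypersurface,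 which in these coordinates is $\mathrm{Re}\,w_1+P(\varphi(w_2))=0$, is rotationally symmetric: $P(\varphi(w_2))=P(\varphi(|w_2|))$ for all $w_2$ near $0$. -/

import Mathlib

open scoped ContDiff Topology

noncomputable section

namespace InfiniteTypeModel

/-- The defining function `ρ(z₁, z₂) = Re z₁ + P(z₂)`. -/
def rho (P : ℂ → ℝ) (z : ℂ × ℂ) : ℝ := z.1.re + P z.2

/-- The real hypersurface `M_P = {(z₁, z₂) : Re z₁ + P(z₂) = 0}`. -/
def hypersurface (P : ℂ → ℝ) : Set (ℂ × ℂ) := {z | rho P z = 0}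

/-- The Wirtinger derivative `∂r/∂z₁ = (∂r/∂x₁ - i ∂r/∂y₁) / 2` of a real function on `ℂ²`. -/
def dz₁ (r : ℂ × ℂ → ℝ) (z : ℂ × ℂ) : ℂ :=
  ((fderiv ℝ r z (1, 0) : ℂ) - Complex.I * (fderiv ℝ r z (Complex.I, 0) : ℂ)) / 2

/-- The Wirtinger derivative `∂r/∂z₂ = (∂r/∂x₂ - i ∂r/∂y₂) / 2` of a real function on `ℂ²`. -/
def dz₂ (r : ℂ × ℂ → ℝ) (z : ℂ × ℂ) : ℂ :=
  ((fderiv ℝ r z (0, 1) : ℂ) - Complex.I * (fderiv ℝ r z (0, Complex.I) : ℂ)) / 2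

/-- The derivative `(Re H) r` of a real function `r` along the real part of the vector field
`H = h₁ ∂_{z₁} + h₂ ∂_{z₂}`, where `H` is given by its pair of coefficients `(h₁, h₂)`. -/
def reApply (H : ℂ × ℂ → ℂ × ℂ) (r : ℂ × ℂ → ℝ) (z : ℂ × ℂ) : ℝ :=
  ((H z).1 * dz₁ r z + (H z).2 * dz₂ r z).re

/-- The germ at `0` of the real part of `H` is tangent to the germ of `M_P` at `0`. -/
def IsTangent (P : ℂ → ℝ) (H : ℂ × ℂ → ℂ × ℂ) : Prop :=
  ∀ᶠ z in 𝓝 (0 : ℂ × ℂ), z ∈ hypersurface P → reApply H (rho P) z = 0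

/-- `H` is (a representative of) an element of `aut₀(M_P, 0)`: a germ at `0` of a holomorphic
vector field on `ℂ²` which vanishes at `0` and whose real part is tangent to `M_P`. -/
structure MemAut₀ (P : ℂ → ℝ) (H : ℂ × ℂ → ℂ × ℂ) : Prop where
  holomorphic : AnalyticAt ℂ H 0
  map_zero : H 0 = 0
  tangent : IsTangent P H

/-- All derivatives of `P` at `0`, of every order including zero, vanish. -/
def VanishesToInfiniteOrder (P : ℂ → ℝ) : Prop :=
  ∀ n : ℕ, iteratedFDeriv ℝ n P 0 = 0

/-- `φ` is a germ at `0` of a biholomorphism of `ℂ` fixing `0`. -/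
structure IsLocalBiholomorphism (φ : ℂ → ℂ) : Prop where
  holomorphic : AnalyticAt ℂ φ 0
  map_zero : φ 0 = 0
  deriv_ne_zero : deriv φ 0 ≠ 0

/-- The change of variable in `z₂` alone: `(w₁, w₂) ↦ (z₁, z₂) = (w₁, φ w₂)`. -/
def changeZ₂ (φ : ℂ → ℂ) (w : ℂ × ℂ) : ℂ × ℂ := (w.1, φ w.2)

/-- Near `0`, the vector field `H` written in the new coordinates `w`, where `z = Φ w`,
is the vector field `N`, that is, `dΦ_w (N w) = H (Φ w)`. -/
def HasForm (H : ℂ × ℂ → ℂ × ℂ) (Φ : ℂ × ℂ → ℂ × ℂ) (N : ℂ × ℂ → ℂ × ℂ) : Prop :=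
  ∀ᶠ w in 𝓝 (0 : ℂ × ℂ), fderiv ℂ Φ w (N w) = H (Φ w)

/-- The rotation field `i β w₂ ∂_{w₂}`. -/
def rotationField (β : ℝ) (w : ℂ × ℂ) : ℂ × ℂ := (0, Complex.I * (β : ℂ) * w.2)

/-- `Q(w) = Q(|w|)` for all `w` near `0`. -/
def IsRotationallySymmetric (Q : ℂ → ℝ) : Prop :=
  ∀ᶠ w in 𝓝 (0 : ℂ), Q w = Q ((‖w‖ : ℝ) : ℂ)

end InfiniteTypeModel

end

/-!
Write `dP` for the real derivative of `P`. On the hypersurface `z₁ = it - P(z)`, `z₂ = z`, tangency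
reads `Re h₁(it - P, z) + dP(h₂(it - P, z)) = 0`, for all small real `t` and complex `z`.

Since `P` and `dP` are flat, `Re h₁(it, ·)` is flat; a flat harmonic function vanishes, so `h₁` does
not depend on `z₂` (`slice_eq_const`). Expanding to first order in `P`, for each fixed `t` the
holomorphic field `v = h₂(it, ·)` on `ℂ` satisfies `dP(v) = c P + P · (flat)` with a real constant
`c`; this is the predicate `IsFlatEigen P v c`.

The heart of the proof is a dichotomy for such `v`: the constant `c` is zero, and either `v = 0` or
`v(z) = iβz + O(z²)` with `β ≠ 0` real. It is obtained from the growth of `P` along integral curves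
of `v`, according to the order of vanishing of `v` at `0`.
* If `v(0) ≠ 0`, then `P` vanishes along the integral curve through `0`.
* If `v` has a simple zero and `Re v'(0) ≠ 0`, there are exponentially small integral curves, along
  which `|P|` decays at a bounded exponential rate although it is flat. So `P = 0`.
* If `v` has a simple zero and `v'(0)` is imaginary, the integral curves are closed, and `c ≠ 0`
  would make `|P|` strictly monotone along them.
* If `v` has a multiple zero of order `n + 1`, the coordinate `s ~ z ^ (-n)` turns `v` into a field
  close to `∂_s` on a half-plane. The flat error term is integrable along its integral curves, so
  that `P` cannot tend to `0` along them, in the direction in which `c P` does not damp it, unless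
  it vanishes on a whole sector.

Each case in which `P` vanishes on a non-trivial connected set through `0` is excluded by the
hypothesis on the zero set.

It follows that `h₁ = 0`, and, applying the dichotomy to real combinations of slices, that
`h₂(z₁, z₂) = F(z₁) v(z₂)` with `v'(0) = i` and `F` real on the imaginary axis
(`exists_factorization`). In the coordinate `w` linearizing `v`, a level curve `P = q` is the spiral
`w₀ exp(i F(it - q) s)`. If `F` were not constant, such spirals with `q ≠ 0` would run into the
origin, where `P = 0` (`deriv_im_eq_zero_of_tangent`). So `F` is a real constant `β`, and `P` is
constant on circles in the coordinate `w`.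
-/

namespace InfiniteTypeModel

open Filter Set Asymptotics

/-! ### Flat functions -/

/-- A smooth function all of whose derivatives vanish at `0` is smaller than every power of the
norm. -/
theorem isBigO_pow_of_iteratedFDeriv_eq_zero (N : ℕ) {F : Type*} [NormedAddCommGroup F]
    [NormedSpace ℝ F] {f : ℂ → F} (hf : ContDiffAt ℝ ∞ f 0)
    (h : ∀ n : ℕ, iteratedFDeriv ℝ n f 0 = 0) : f =O[𝓝 0] fun z => ‖z‖ ^ N := by
  induction N generalizing F with
  | zero => simpa using hf.continuousAt.tendsto.isBigO_one ℝ
  | succ N ih =>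
    have hf' : ContDiffAt ℝ ∞ (fderiv ℝ f) 0 := hf.fderiv_right (by simp)
    have hD := ih hf' fun n => by
      rw [← norm_eq_zero, norm_iteratedFDeriv_fderiv, h, norm_zero]
    have hd : ∀ᶠ z in 𝓝 (0 : ℂ), DifferentiableAt ℝ f z := by
      filter_upwards [(hf.of_le (m := 1) (by exact_mod_cast le_top)).eventually (by simp)] with z hz
      exact hz.differentiableAt (by simp)
    have h0 : f 0 = 0 := by
      have := congrArg norm (h 0)
      rwa [norm_iteratedFDeriv_zero, norm_zero, norm_eq_zero] at this
    obtain ⟨C, hC⟩ := hD.bound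
    obtain ⟨r, hr, hball⟩ := Metric.eventually_nhds_iff_ball.1 (hC.and hd)
    refine IsBigO.of_bound C ?_
    filter_upwards [Metric.ball_mem_nhds (0 : ℂ) hr] with z hz
    have hsub : ∀ x ∈ Metric.closedBall (0 : ℂ) ‖z‖, x ∈ Metric.ball (0 : ℂ) r := fun x hx => by
      simp only [mem_closedBall_zero_iff, mem_ball_zero_iff] at *
      linarith
    have hC0 : 0 ≤ C * ‖z‖ ^ N := by
      have := (hball z hz).1
      simp only [norm_pow, norm_norm] at this
      exact (norm_nonneg _).trans this
    have := (convex_closedBall (0 : ℂ) ‖z‖).norm_image_sub_le_of_norm_fderiv_le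
      (f := f) (C := C * ‖z‖ ^ N) (fun x hx => (hball x (hsub x hx)).2) (fun x hx => by
        have h1 := (hball x (hsub x hx)).1
        simp only [norm_pow, norm_norm] at h1
        rcases eq_or_ne z 0 with rfl | hz0
        · have : x = 0 := by simpa using hx
          simpa [this] using h1
        refine h1.trans ?_
        have hzN : 0 < ‖z‖ ^ N := by positivity
        have hC1 : 0 ≤ C := nonneg_of_mul_nonneg_left hC0 hzN
        gcongr
        simpa using hx) (x := 0) (y := z) (by simp) (by simp)
    simpa [h0, pow_succ, mul_assoc] using this

/-! ### Differential inequalities along curves -/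

/-- Gronwall's inequality with the integrating factor `exp A`. -/
theorem monotoneOn_mul_exp {y y' A A' : ℝ → ℝ} {T : ℝ}
    (hy : ∀ t ∈ Icc 0 T, HasDerivWithinAt y (y' t) (Icc 0 T) t)
    (hA : ∀ t ∈ Icc 0 T, HasDerivWithinAt A (A' t) (Icc 0 T) t)
    (h : ∀ t ∈ Icc 0 T, 0 ≤ y' t + A' t * y t) :
    MonotoneOn (fun t => y t * Real.exp (A t)) (Icc 0 T) := by
  have hd : ∀ t ∈ Icc 0 T, HasDerivWithinAt (fun t => y t * Real.exp (A t))
      ((y' t + A' t * y t) * Real.exp (A t)) (Icc 0 T) t := fun t ht =>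
    ((hy t ht).mul (hA t ht).exp).congr_deriv (by ring)
  refine monotoneOn_of_hasDerivWithinAt_nonneg (convex_Icc 0 T)
    (fun t ht => (hd t ht).continuousWithinAt)
    (fun t ht => (hd t (interior_subset ht)).mono interior_subset) fun t ht => ?_
  exact mul_nonneg (h t (interior_subset ht)) (Real.exp_pos _).le

/-! ### Identity theorems -/

/-- Near `0`, a holomorphic function of one variable is determined by its restriction to the
imaginary axis. -/
theorem eventually_eq_zero_of_imaginary_axis {g : ℂ → ℂ} (hg : AnalyticAt ℂ g 0)
    (h : ∀ᶠ t : ℝ in 𝓝 0, g (Complex.I * t) = 0) : ∀ᶠ u in 𝓝 0, g u = 0 := by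
  refine hg.frequently_zero_iff_eventually_zero.1 ?_
  have ht : Tendsto (fun t : ℝ => Complex.I * t) (𝓝[≠] 0) (𝓝[≠] 0) := by
    refine tendsto_nhdsWithin_iff.2 ⟨?_, ?_⟩
    · have : Continuous fun t : ℝ => Complex.I * t := by fun_prop
      simpa using (this.tendsto 0).mono_left nhdsWithin_le_nhds
    · filter_upwards [self_mem_nhdsWithin] with t ht
      simpa using ht
  exact ht.frequently (h.filter_mono nhdsWithin_le_nhds).frequently

/-- Near `0`, a holomorphic function `G(u, z)` vanishes if, for each small imaginary `u`, the germ
at `0` of `G(u, ·)` vanishes; the domain of vanishing of this germ may depend on `u`. -/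
theorem eventually_eq_zero_of_imaginary_slices {G : ℂ × ℂ → ℂ} (hG : AnalyticAt ℂ G 0)
    (h : ∀ᶠ t : ℝ in 𝓝 0, ∀ᶠ z in 𝓝 (0 : ℂ), G (Complex.I * t, z) = 0) :
    ∀ᶠ w in 𝓝 0, G w = 0 := by
  obtain ⟨r, hr, hball⟩ := Metric.eventually_nhds_iff_ball.1 hG.eventually_analyticAt
  have hmem : ∀ u z : ℂ, u ∈ Metric.ball (0 : ℂ) r → z ∈ Metric.ball (0 : ℂ) r →
      (u, z) ∈ Metric.ball (0 : ℂ × ℂ) r := fun u z hu hz => by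
    rw [← Prod.mk_zero_zero, ← ball_prod_same]; exact ⟨hu, hz⟩
  have h0 : (0 : ℂ) ∈ Metric.ball (0 : ℂ) r := Metric.mem_ball_self hr
  have hpre : IsPreconnected (Metric.ball (0 : ℂ) r) := (convex_ball _ _).isPreconnected
  have hslice : ∀ᶠ t : ℝ in 𝓝 0, ∀ z ∈ Metric.ball (0 : ℂ) r, G (Complex.I * t, z) = 0 := by
    have hc : Tendsto (fun t : ℝ => Complex.I * t) (𝓝 0) (𝓝 0) := by
      have : Continuous fun t : ℝ => Complex.I * t := by fun_prop
      simpa using this.tendsto 0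
    filter_upwards [h, hc (Metric.ball_mem_nhds 0 hr)] with t ht htr
    have han : AnalyticOnNhd ℂ (fun z => G (Complex.I * t, z)) (Metric.ball 0 r) := fun z hz =>
      (hball _ (hmem _ z htr hz)).comp₂ analyticAt_const analyticAt_id
    exact han.eqOn_zero_of_preconnected_of_eventuallyEq_zero hpre h0 ht
  filter_upwards [Metric.ball_mem_nhds (0 : ℂ × ℂ) hr] with w hw
  rw [← Prod.mk_zero_zero, ← ball_prod_same] at hw
  have han : AnalyticOnNhd ℂ (fun u => G (u, w.2)) (Metric.ball 0 r) := fun u hu =>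
    (hball _ (hmem u _ hu hw.2)).comp₂ analyticAt_id analyticAt_const
  exact han.eqOn_zero_of_preconnected_of_eventuallyEq_zero hpre h0
    (eventually_eq_zero_of_imaginary_axis (han 0 h0)
      (hslice.mono fun t ht => ht _ hw.2)) hw.1

/-- A holomorphic germ whose real part is flat is an imaginary constant. -/
theorem eventually_eq_of_re_isBigO_pow {f : ℂ → ℂ} (hf : AnalyticAt ℂ f 0)
    (h : ∀ N : ℕ, (fun z => (f z).re) =O[𝓝 0] fun z => ‖z‖ ^ N) :
    (f 0).re = 0 ∧ ∀ᶠ z in 𝓝 0, f z = f 0 := by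
  have h0 : (f 0).re = 0 := by
    obtain ⟨C, hC⟩ := (h 1).bound
    simpa using hC.self_of_nhds
  refine ⟨h0, ?_⟩
  by_contra hne
  have hne' : ¬ ∀ᶠ z in 𝓝 (0 : ℂ), (fun z => f z - f 0) z = 0 := by
    simpa only [sub_eq_zero] using hne
  obtain ⟨n, a, ha, ha0, hfa⟩ :=
    (hf.sub analyticAt_const).exists_eventuallyEq_pow_smul_nonzero_iff.2 hne'
  have hn : n ≠ 0 := by
    rintro rfl
    have := hfa.self_of_nhds
    simp at this
    exact ha0 this.symm
  -- Along the ray through `ζ`, the leading term of `f` is real and positive.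
  obtain ⟨ζ, hζ⟩ := IsAlgClosed.exists_pow_nat_eq (starRingEnd ℂ (a 0)) (Nat.pos_of_ne_zero hn)
  have hray : Tendsto (fun r : ℝ => (r : ℂ) * ζ) (𝓝[>] 0) (𝓝 0) := by
    have : Continuous fun r : ℝ => (r : ℂ) * ζ := by fun_prop
    simpa using (this.tendsto 0).mono_left nhdsWithin_le_nhds
  have hlim : Tendsto (fun r : ℝ => (ζ ^ n * a (r * ζ)).re) (𝓝[>] 0) (𝓝 (ζ ^ n * a 0).re) :=
    (Complex.continuous_re.tendsto _).comp
      (tendsto_const_nhds.mul (ha.continuousAt.tendsto.comp hray))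
  obtain ⟨C, hC⟩ := (h (n + 1)).bound
  have hbound : ∀ᶠ r : ℝ in 𝓝[>] 0, (ζ ^ n * a (r * ζ)).re ≤ C * ‖ζ‖ ^ (n + 1) * r := by
    filter_upwards [hray.eventually hC, hray.eventually hfa, self_mem_nhdsWithin] with r h1 h2 hr
    have hr : 0 < r := hr
    have h3 : f (r * ζ) = f 0 + (r ^ n : ℝ) * (ζ ^ n * a (r * ζ)) := by
      push_cast
      simp only [Pi.sub_apply, sub_zero, smul_eq_mul, mul_pow] at h2
      linear_combination h2
    have h4 : r ^ n * (ζ ^ n * a (r * ζ)).re ≤ r ^ n * (C * ‖ζ‖ ^ (n + 1) * r) := by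
      have h5 : (f (r * ζ)).re = r ^ n * (ζ ^ n * a (r * ζ)).re := by
        rw [h3, Complex.add_re, h0, Complex.re_ofReal_mul, zero_add]
      rw [← h5]
      refine (le_abs_self _).trans (h1.trans (le_of_eq ?_))
      simp only [norm_pow, norm_norm, norm_mul, Complex.norm_real, Real.norm_of_nonneg hr.le,
        mul_pow]
      ring
    exact le_of_mul_le_mul_left h4 (by positivity)
  have hlim0 : Tendsto (fun r : ℝ => C * ‖ζ‖ ^ (n + 1) * r) (𝓝[>] 0) (𝓝 0) := by
    have : Continuous fun r : ℝ => C * ‖ζ‖ ^ (n + 1) * r := by fun_prop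
    simpa using (this.tendsto 0).mono_left nhdsWithin_le_nhds
  have hle := le_of_tendsto_of_tendsto hlim hlim0 hbound
  rw [hζ, mul_comm, Complex.mul_conj, Complex.ofReal_re] at hle
  exact ha0 (Complex.normSq_eq_zero.1 (le_antisymm hle (Complex.normSq_nonneg _)))

/-! ### Linearization of a holomorphic vector field on `ℂ` -/

/-- A holomorphic vector field `v ∂_z` on `ℂ` with a simple zero at `0` is linear in a suitable
holomorphic coordinate: `φ` carries `v'(0) w ∂_w` to `v ∂_z`. The inverse coordinate is
`ψ(z) = z exp ∫ (v'(0) / v - 1 / z)`, which solves `ψ' v = v'(0) ψ`. -/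
theorem exists_linearization {v : ℂ → ℂ} (hv : AnalyticAt ℂ v 0) (hv0 : v 0 = 0)
    (hμ : deriv v 0 ≠ 0) :
    ∃ φ : ℂ → ℂ, IsLocalBiholomorphism φ ∧
      ∀ᶠ w in 𝓝 0, deriv φ w * (deriv v 0 * w) = v (φ w) := by
  have hdslope : ∀ {f : ℂ → ℂ}, AnalyticAt ℂ f 0 → AnalyticAt ℂ (dslope f 0) 0 := by
    rintro f ⟨p, hp⟩
    exact ⟨_, hp.has_fpower_series_dslope_fslope⟩
  have hmul : ∀ (f : ℂ → ℂ) z, z * dslope f 0 z = f z - f 0 := fun f z => by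
    simpa using sub_smul_dslope f 0 z
  set μ := deriv v 0 with hμdef
  set k := dslope v 0 with hk
  have hka : AnalyticAt ℂ k 0 := hdslope hv
  have hk0 : k 0 = μ := dslope_same v 0
  have hkne : k 0 ≠ 0 := hk0 ▸ hμ
  set q : ℂ → ℂ := fun z => μ / k z with hq
  have hqa : AnalyticAt ℂ q 0 := analyticAt_const.div hka hkne
  have hq0 : q 0 = 1 := by simp [hq, hk0, hμ]
  have hm : AnalyticAt ℂ (dslope q 0) 0 := hdslope hqa
  obtain ⟨r, hr, hball⟩ := Metric.eventually_nhds_iff_ball.1 hm.eventually_analyticAt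
  have hmd : DifferentiableOn ℂ (dslope q 0) (Metric.ball 0 r) := fun z hz =>
    (hball z hz).differentiableAt.differentiableWithinAt
  obtain ⟨M, hM⟩ := hmd.isExactOn_ball
  have hr0 : Metric.ball (0 : ℂ) r ∈ 𝓝 0 := Metric.ball_mem_nhds 0 hr
  have hMa : AnalyticAt ℂ M 0 :=
    DifferentiableOn.analyticAt (s := Metric.ball 0 r)
      (fun z hz => (hM z hz).differentiableAt.differentiableWithinAt) hr0
  set ψ : ℂ → ℂ := fun z => z * Complex.exp (M z) with hψ
  have hψa : AnalyticAt ℂ ψ 0 := analyticAt_id.mul hMa.cexp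
  have hψd : ∀ᶠ z in 𝓝 0, HasDerivAt ψ (Complex.exp (M z) * q z) z := by
    filter_upwards [hr0] with z hz
    refine ((hasDerivAt_id z).mul (hM z hz).cexp).congr_deriv ?_
    have := hmul q z
    rw [hq0] at this
    simp only [id]
    linear_combination Complex.exp (M z) * this
  have hψ0 : ψ 0 = 0 := by simp [hψ]
  have hψ' : deriv ψ 0 ≠ 0 := by
    rw [hψd.self_of_nhds.deriv, hq0]
    simp [Complex.exp_ne_zero]
  set φ := hψa.hasStrictDerivAt.localInverse ψ _ 0 hψ' with hφ
  have hφa : AnalyticAt ℂ φ 0 := by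
    have := hψa.analyticAt_localInverse hψ'
    rwa [hψ0] at this
  have hφ0 : φ 0 = 0 := by
    have := (hψa.hasStrictDerivAt.eventually_left_inverse hψ').self_of_nhds
    rwa [hψ0] at this
  have hinv : ∀ᶠ w in 𝓝 0, ψ (φ w) = w := by
    have := hψa.hasStrictDerivAt.eventually_right_inverse hψ'
    rwa [hψ0] at this
  have hφt : Tendsto φ (𝓝 0) (𝓝 0) := by
    have := hφa.continuousAt.tendsto
    rwa [hφ0] at this
  have hchain : ∀ᶠ w in 𝓝 0, Complex.exp (M (φ w)) * q (φ w) * deriv φ w = 1 := by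
    filter_upwards [hinv.eventually_nhds, hφt.eventually hψd, hφa.eventually_analyticAt]
      with w h1 h2 h3
    have h4 := h2.comp w h3.differentiableAt.hasDerivAt
    exact h4.unique ((hasDerivAt_id w).congr_of_eventuallyEq h1)
  refine ⟨φ, ⟨hφa, hφ0, fun h => ?_⟩, ?_⟩
  · have := hchain.self_of_nhds
    simp [h] at this
  · filter_upwards [hinv, hchain, hφt.eventually (hka.continuousAt.eventually_ne hkne)]
      with w h1 h2 h3
    have h4 : φ w * k (φ w) = v (φ w) := by simpa [hv0] using hmul v (φ w)
    have h5 : q (φ w) * k (φ w) = μ := div_mul_cancel₀ _ h3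
    have h6 : w = φ w * Complex.exp (M (φ w)) := h1.symm
    rw [← h4]
    linear_combination μ * deriv φ w * h6 + φ w * k (φ w) * h2
      - φ w * deriv φ w * Complex.exp (M (φ w)) * h5

theorem IsLocalBiholomorphism.tendsto {φ : ℂ → ℂ} (hφ : IsLocalBiholomorphism φ) :
    Tendsto φ (𝓝 0) (𝓝 0) := by
  have := hφ.holomorphic.continuousAt.tendsto
  rwa [hφ.map_zero] at this

theorem IsLocalBiholomorphism.map_nhds {φ : ℂ → ℂ} (hφ : IsLocalBiholomorphism φ) :
    map φ (𝓝 0) = 𝓝 0 := by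
  have := hφ.holomorphic.hasStrictDerivAt.map_nhds_eq hφ.deriv_ne_zero
  rwa [hφ.map_zero] at this

/-! ### Flat germs with an isolated zero component -/

/-- The properties of the germ of `P` at `0` on which the argument rests: differentiability,
flatness of `P` and of its derivative, and the absence of non-trivial connected sets through `0`
on which `P` vanishes. -/
structure IsIsolatedFlat (P : ℂ → ℝ) : Prop where
  differentiable : ∀ᶠ z in 𝓝 (0 : ℂ), DifferentiableAt ℝ P z
  flat : ∀ N : ℕ, P =O[𝓝 0] fun z => ‖z‖ ^ N
  fderiv_flat : ∀ N : ℕ, fderiv ℝ P =O[𝓝 0] fun z => ‖z‖ ^ N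
  isolated : ∃ r > 0, ∀ S ⊆ Metric.ball (0 : ℂ) r, IsPreconnected S → 0 ∈ S →
    (∀ z ∈ S, P z = 0) → S ⊆ {0}

theorem isIsolatedFlat_of_vanishesToInfiniteOrder {U : Set ℂ} (hU : IsOpen U) (h0 : (0 : ℂ) ∈ U)
    {P : ℂ → ℝ} (hP : ContDiffOn ℝ ∞ P U)
    (hzero : connectedComponentIn {z | z ∈ U ∧ P z = 0} 0 = {0})
    (hinf : VanishesToInfiniteOrder P) : IsIsolatedFlat P := by
  have hU0 : U ∈ 𝓝 (0 : ℂ) := hU.mem_nhds h0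
  have hP0 : ContDiffAt ℝ ∞ P 0 := hP.contDiffAt hU0
  refine ⟨?_, fun N => isBigO_pow_of_iteratedFDeriv_eq_zero N hP0 hinf, fun N =>
    isBigO_pow_of_iteratedFDeriv_eq_zero N (hP0.fderiv_right (by simp)) fun n => ?_, ?_⟩
  · filter_upwards [hU0] with z hz
    exact (hP.contDiffAt (hU.mem_nhds hz)).differentiableAt (by simp)
  · rw [← norm_eq_zero, norm_iteratedFDeriv_fderiv, hinf, norm_zero]
  · obtain ⟨r, hr, hrU⟩ := Metric.mem_nhds_iff.1 hU0
    refine ⟨r, hr, fun S hS hpre h0S hPS => ?_⟩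
    rw [← hzero]
    exact hpre.subset_connectedComponentIn h0S fun z hz => ⟨hrU (hS hz), hPS z hz⟩

namespace IsIsolatedFlat

variable {P : ℂ → ℝ}

theorem map_zero (hP : IsIsolatedFlat P) : P 0 = 0 := by
  obtain ⟨C, hC⟩ := (hP.flat 1).bound
  simpa using hC.self_of_nhds

theorem tendsto (hP : IsIsolatedFlat P) : Tendsto P (𝓝 0) (𝓝 0) := by
  have := hP.differentiable.self_of_nhds.continuousAt.tendsto
  rwa [hP.map_zero] at this

theorem not_eventually_eq_zero (hP : IsIsolatedFlat P) : ¬ ∀ᶠ z in 𝓝 0, P z = 0 := by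
  intro h
  obtain ⟨r, hr, hiso⟩ := hP.isolated
  obtain ⟨s, hs, hball⟩ := Metric.eventually_nhds_iff_ball.1 h
  have hm : 0 < min r s := lt_min hr hs
  have := hiso (Metric.ball 0 (min r s)) (Metric.ball_subset_ball (min_le_left _ _))
    (convex_ball _ _).isPreconnected (Metric.mem_ball_self hm)
    fun z hz => hball z (Metric.ball_subset_ball (min_le_right _ _) hz)
  have h1 := @this ((min r s / 2 : ℝ) : ℂ) (by
    rw [mem_ball_zero_iff, Complex.norm_real, Real.norm_of_nonneg (by positivity)]; linarith)
  rw [mem_singleton_iff] at h1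
  have h2 : min r s / 2 = 0 := by exact_mod_cast h1
  linarith

end IsIsolatedFlat

/-- The germ of `P` is an eigenvector, with real eigenvalue `c`, of the derivation along the real
vector field with components `v`, up to errors of the form `P` times a flat factor. -/
def IsFlatEigen (P : ℂ → ℝ) (v : ℂ → ℂ) (c : ℝ) : Prop :=
  ∀ N : ℕ, (fun z => fderiv ℝ P z (v z) - c * P z) =O[𝓝 0] fun z => P z * ‖z‖ ^ N

namespace IsFlatEigen

variable {P : ℂ → ℝ} {v w : ℂ → ℂ} {c d : ℝ}

theorem sub (h : IsFlatEigen P v c) (h' : IsFlatEigen P w d) :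
    IsFlatEigen P (fun z => v z - w z) (c - d) := fun N => by
  refine ((h N).sub (h' N)).congr_left fun z => ?_
  rw [map_sub]; ring

theorem const_smul (h : IsFlatEigen P v c) (a : ℝ) :
    IsFlatEigen P (fun z => a • v z) (a * c) := fun N => by
  refine ((h N).const_mul_left a).congr_left fun z => ?_
  rw [map_smul, smul_eq_mul]; ring

theorem neg (h : IsFlatEigen P v c) : IsFlatEigen P (fun z => -v z) (-c) := by
  simpa using h.const_smul (-1)

/-- Explicit constants in the definition of `IsFlatEigen`. -/
theorem exists_bound (hP : IsIsolatedFlat P) (h : IsFlatEigen P v c) (N : ℕ) :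
    ∃ C ≥ 0, ∃ δ > 0, ∀ z ∈ Metric.ball (0 : ℂ) δ, DifferentiableAt ℝ P z ∧
      |fderiv ℝ P z (v z) - c * P z| ≤ C * ‖z‖ ^ N * |P z| := by
  obtain ⟨C, hC0, hC⟩ := (h N).exists_nonneg
  obtain ⟨δ, hδ, hball⟩ := Metric.eventually_nhds_iff_ball.1 (hP.differentiable.and hC.bound)
  refine ⟨C, hC0, δ, hδ, fun z hz => ⟨(hball z hz).1, (hball z hz).2.trans (le_of_eq ?_)⟩⟩
  simp only [norm_mul, norm_pow, Real.norm_eq_abs, abs_norm]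
  ring

end IsFlatEigen

/-- Growth of `P ^ 2` along an integral curve `z` of `v`, in terms of a function `A` whose
derivative dominates twice the relative rate of decay of `|P|`. -/
theorem sq_mul_exp_le_of_integralCurve {P : ℂ → ℝ} {v : ℂ → ℂ} {c C δ T : ℝ} {N : ℕ}
    (hT : 0 ≤ T)
    (hb : ∀ z ∈ Metric.ball (0 : ℂ) δ, DifferentiableAt ℝ P z ∧
      |fderiv ℝ P z (v z) - c * P z| ≤ C * ‖z‖ ^ N * |P z|)
    {z : ℝ → ℂ} (hzδ : ∀ t ∈ Icc 0 T, z t ∈ Metric.ball (0 : ℂ) δ)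
    (hz : ∀ t ∈ Icc 0 T, HasDerivWithinAt z (v (z t)) (Icc 0 T) t)
    {A A' : ℝ → ℝ} (hA : ∀ t ∈ Icc 0 T, HasDerivWithinAt A (A' t) (Icc 0 T) t)
    (hAC : ∀ t ∈ Icc 0 T, 2 * C * ‖z t‖ ^ N ≤ A' t + 2 * c) :
    P (z 0) ^ 2 * Real.exp (A 0) ≤ P (z T) ^ 2 * Real.exp (A T) := by
  have hd : ∀ t ∈ Icc 0 T, HasDerivWithinAt (fun t => P (z t) ^ 2)
      (2 * P (z t) * fderiv ℝ P (z t) (v (z t))) (Icc 0 T) t := fun t ht => by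
    have h1 := (hb _ (hzδ t ht)).1.hasFDerivAt.comp_hasDerivWithinAt t (hz t ht)
    exact (h1.pow 2).congr_deriv (by simp)
  refine monotoneOn_mul_exp hd hA (fun t ht => ?_) (left_mem_Icc.2 hT) (right_mem_Icc.2 hT) hT
  have h1 := (hb _ (hzδ t ht)).2
  set p := P (z t)
  set D := fderiv ℝ P (z t) (v (z t))
  have h2 : -(C * ‖z t‖ ^ N * p ^ 2) ≤ p * (D - c * p) := by
    have h3 : |p * (D - c * p)| ≤ C * ‖z t‖ ^ N * p ^ 2 := by
      rw [abs_mul, ← sq_abs p]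
      nlinarith [mul_le_mul_of_nonneg_left h1 (abs_nonneg p)]
    exact neg_le_of_abs_le h3
  nlinarith [mul_le_mul_of_nonneg_right (hAC t ht) (sq_nonneg p)]

/-! ### Integral curves through or into the origin -/

/-- The integral curves of `v` in the coordinate that linearizes `v`. -/
theorem hasDerivWithinAt_linearized {φ v : ℂ → ℂ} {μ w₀ : ℂ} {S : Set ℝ}
    {t : ℝ} (hφ : DifferentiableAt ℂ φ (w₀ * Complex.exp (μ * t)))
    (hv : deriv φ (w₀ * Complex.exp (μ * t)) * (μ * (w₀ * Complex.exp (μ * t))) =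
      v (φ (w₀ * Complex.exp (μ * t)))) :
    HasDerivWithinAt (fun t : ℝ => φ (w₀ * Complex.exp (μ * t)))
      (v (φ (w₀ * Complex.exp (μ * t)))) S t := by
  have h1 : HasDerivAt (fun z : ℂ => φ (w₀ * Complex.exp (μ * z)))
      (deriv φ (w₀ * Complex.exp (μ * t)) * (w₀ * (Complex.exp (μ * t) * (μ * 1)))) (t : ℂ) :=
    HasDerivAt.comp (t : ℂ) hφ.hasDerivAt
      ((((hasDerivAt_id (t : ℂ)).const_mul μ).cexp).const_mul w₀)
  refine (h1.comp_ofReal.congr_deriv ?_).hasDerivWithinAt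
  rw [← hv]; ring

theorem norm_mul_exp_le {w₀ μ : ℂ} {t : ℝ} (h : μ.re * t ≤ 0) :
    ‖w₀ * Complex.exp (μ * t)‖ ≤ ‖w₀‖ := by
  rw [norm_mul, Complex.norm_exp]
  have : (μ * t).re ≤ 0 := by simpa using h
  exact mul_le_of_le_one_right (norm_nonneg _) (Real.exp_le_one_iff.2 this)

namespace IsFlatEigen

variable {P : ℂ → ℝ} {v : ℂ → ℂ} {c : ℝ}

/-- If `v(0) ≠ 0`, then `P` would vanish along the integral curve of `v` through the origin. -/
theorem map_zero_eq_zero (hP : IsIsolatedFlat P) (hv : AnalyticAt ℂ v 0)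
    (h : IsFlatEigen P v c) : v 0 = 0 := by
  by_contra hv0
  obtain ⟨α, hα0, ε, hε, hα⟩ :=
    ContDiffAt.exists_forall_mem_closedBall_exists_eq_forall_mem_Ioo_hasDerivAt₀
      (hv.contDiffAt.restrict_scalars ℝ : ContDiffAt ℝ 1 v 0) 0
  simp only [zero_sub, zero_add] at hα
  obtain ⟨C, hC0, δ, hδ, hb⟩ := h.exists_bound hP 0
  obtain ⟨r, hr, hiso⟩ := hP.isolated
  have hα0' : HasDerivAt α (v 0) 0 := by
    simpa [hα0] using hα 0 ⟨by linarith, hε⟩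
  have hαt : Tendsto α (𝓝 0) (𝓝 0) := by
    simpa [hα0] using hα0'.continuousAt.tendsto
  obtain ⟨η, hη, hηb⟩ := Metric.eventually_nhds_iff_ball.1
    ((hαt.eventually (Metric.ball_mem_nhds 0 (lt_min hδ hr))).and
      (Ioo_mem_nhds (neg_lt_zero.2 hε) hε))
  have hmem : ∀ t ∈ Ioc (-η) 0, t ∈ Metric.ball (0 : ℝ) η := fun t ht => by
    rw [mem_ball_zero_iff, Real.norm_eq_abs, abs_lt]
    exact ⟨ht.1, ht.2.trans_lt hη⟩
  have hzero : ∀ t ∈ Ioc (-η) 0, P (α t) = 0 := fun t ht => by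
    have hT : 0 ≤ -t := by linarith [ht.2]
    have hs : ∀ s ∈ Icc 0 (-t), s + t ∈ Ioc (-η) 0 := fun s hs =>
      ⟨by linarith [hs.1, ht.1], by linarith [hs.2]⟩
    have := sq_mul_exp_le_of_integralCurve (z := fun s => α (s + t)) (c := c) hT hb
      (fun s hs' => Metric.ball_subset_ball (min_le_left _ _) (hηb _ (hmem _ (hs s hs'))).1)
      (fun s hs' => ((hα _ (hηb _ (hmem _ (hs s hs'))).2).comp_add_const s t).hasDerivWithinAt)
      (A := fun s => (2 * C - 2 * c) * s) (A' := fun _ => 2 * C - 2 * c)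
      (fun s _ => by simpa using ((hasDerivAt_id s).const_mul (2 * C - 2 * c)).hasDerivWithinAt)
      (fun s _ => by simp)
    simp only [zero_add, mul_zero, Real.exp_zero, mul_one, neg_add_cancel, hα0, hP.map_zero] at this
    have h2 : P (α t) ^ 2 ≤ 0 := by simpa using this
    exact pow_eq_zero_iff (two_ne_zero) |>.1 (le_antisymm h2 (sq_nonneg _))
  have hS : α '' Ioc (-η) 0 ⊆ {0} := by
    refine hiso _ ?_ ?_ ⟨0, ⟨by linarith, le_rfl⟩, hα0⟩ ?_
    · rintro _ ⟨t, ht, rfl⟩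
      exact Metric.ball_subset_ball (min_le_right _ _) (hηb _ (hmem t ht)).1
    · exact isPreconnected_Ioc.image _ fun t ht =>
        (hα t (hηb _ (hmem t ht)).2).continuousAt.continuousWithinAt
    · rintro _ ⟨t, ht, rfl⟩
      exact hzero t ht
  have hne : ∀ᶠ t in 𝓝[<] (0 : ℝ), α t ≠ 0 :=
    (hα0'.eventually_ne hv0).filter_mono
      (nhdsWithin_mono _ fun t ht => ne_of_lt ht)
  obtain ⟨t, ht, ht'⟩ := (hne.and (Ioo_mem_nhdsLT (neg_lt_zero.2 hη))).exists
  exact ht (hS ⟨t, ⟨ht'.1, ht'.2.le⟩, rfl⟩)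

/-- If the integral curves of `v` tended to `0` exponentially, then so fast a decay of `P` along
them as flatness requires would contradict the differential inequality. -/
theorem not_re_deriv_neg (hP : IsIsolatedFlat P) (hv : AnalyticAt ℂ v 0) (hv0 : v 0 = 0)
    (h : IsFlatEigen P v c) : ¬ (deriv v 0).re < 0 := by
  intro hre
  have hμ : deriv v 0 ≠ 0 := fun h0 => by simp [h0] at hre
  obtain ⟨φ, hφ, hlin⟩ := exists_linearization hv hv0 hμ
  set μ := deriv v 0
  obtain ⟨C, hC0, δ, hδ, hb⟩ := h.exists_bound hP 0
  -- The order of flatness that beats the exponential rate `C - c`.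
  obtain ⟨N, hN⟩ := exists_nat_gt ((C - c) / (-μ.re))
  rw [div_lt_iff₀ (by linarith)] at hN
  have hflat : (fun w => P (φ w)) =O[𝓝 0] fun w => ‖w‖ ^ N := by
    refine ((hP.flat N).comp_tendsto hφ.tendsto).trans ?_
    have : φ =O[𝓝 0] fun w => w := by
      simpa [hφ.map_zero] using hφ.holomorphic.differentiableAt.isBigO_sub
    exact this.norm_norm.pow N
  obtain ⟨K, hK⟩ := hflat.bound
  refine hP.not_eventually_eq_zero ?_
  rw [← hφ.map_nhds, eventually_map]
  obtain ⟨η, hη, hηb⟩ := Metric.eventually_nhds_iff_ball.1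
    ((hlin.and hφ.holomorphic.eventually_analyticAt).and
      ((hφ.tendsto.eventually (Metric.ball_mem_nhds 0 hδ)).and hK))
  filter_upwards [Metric.ball_mem_nhds 0 hη] with w₀ hw₀
  have hmem : ∀ t : ℝ, 0 ≤ t → w₀ * Complex.exp (μ * t) ∈ Metric.ball (0 : ℂ) η := fun t ht => by
    rw [mem_ball_zero_iff] at *
    exact (norm_mul_exp_le (mul_nonpos_of_nonpos_of_nonneg hre.le ht)).trans_lt hw₀
  have hmain : ∀ T : ℝ, 0 ≤ T →
      P (φ w₀) ^ 2 ≤ (K * ‖w₀‖ ^ N) ^ 2 * Real.exp ((2 * (C - c - N * (-μ.re))) * T) := fun T hT => by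
    have := sq_mul_exp_le_of_integralCurve (z := fun t => φ (w₀ * Complex.exp (μ * t)))
      (c := c) hT hb (fun t ht => (hηb _ (hmem t ht.1)).2.1)
      (fun t ht => hasDerivWithinAt_linearized (hηb _ (hmem t ht.1)).1.2.differentiableAt
        (hηb _ (hmem t ht.1)).1.1)
      (A := fun s => (2 * C - 2 * c) * s) (A' := fun _ => 2 * C - 2 * c)
      (fun s _ => by simpa using ((hasDerivAt_id s).const_mul (2 * C - 2 * c)).hasDerivWithinAt)
      (fun s _ => by simp)
    simp only [mul_zero, Real.exp_zero, mul_one, Complex.ofReal_zero, Complex.exp_zero] at this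
    refine this.trans ?_
    have h1 := (hηb _ (hmem T hT)).2.2
    have h2 : P (φ (w₀ * Complex.exp (μ * T))) ^ 2 ≤
        (K * ‖w₀‖ ^ N) ^ 2 * Real.exp (2 * (N * (μ.re * T))) := by
      rw [Real.norm_eq_abs, norm_pow, norm_norm, norm_mul, Complex.norm_exp, mul_pow,
        ← Real.exp_nat_mul] at h1
      have h3 : (μ * T).re = μ.re * T := by simp
      rw [h3] at h1
      calc P (φ (w₀ * Complex.exp (μ * T))) ^ 2
          = |P (φ (w₀ * Complex.exp (μ * T)))| ^ 2 := (sq_abs _).symm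
        _ ≤ (K * (‖w₀‖ ^ N * Real.exp (N * (μ.re * T)))) ^ 2 := by gcongr
        _ = _ := by rw [← mul_assoc, mul_pow _ (Real.exp _), ← Real.exp_nat_mul]; norm_num
    calc _ ≤ (K * ‖w₀‖ ^ N) ^ 2 * Real.exp (2 * (N * (μ.re * T))) *
          Real.exp ((2 * C - 2 * c) * T) := by gcongr
      _ = _ := by rw [mul_assoc, ← Real.exp_add]; ring_nf
  have hlim : Tendsto (fun T : ℝ => (K * ‖w₀‖ ^ N) ^ 2 *
      Real.exp ((2 * (C - c - N * (-μ.re))) * T)) atTop (𝓝 ((K * ‖w₀‖ ^ N) ^ 2 * 0)) := by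
    refine tendsto_const_nhds.mul (Real.tendsto_exp_atBot.comp ?_)
    exact tendsto_id.const_mul_atTop_of_neg (by linarith)
  have hle := ge_of_tendsto hlim ((eventually_ge_atTop 0).mono hmain)
  rw [mul_zero] at hle
  exact pow_eq_zero_iff two_ne_zero |>.1 (le_antisymm hle (sq_nonneg _))

theorem re_deriv_eq_zero (hP : IsIsolatedFlat P) (hv : AnalyticAt ℂ v 0)
    (h : IsFlatEigen P v c) : (deriv v 0).re = 0 := by
  have hv0 := h.map_zero_eq_zero hP hv
  refine le_antisymm (not_lt.1 fun hlt => ?_) (not_lt.1 (h.not_re_deriv_neg hP hv hv0))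
  refine h.neg.not_re_deriv_neg hP hv.neg (by simp [hv0]) ?_
  rw [deriv.neg]
  simpa using hlt

/-- If the integral curves of `v` are closed, then the eigenvalue cannot be positive, since
`P ^ 2` would increase strictly along them. -/
theorem not_pos_of_deriv_ne_zero (hP : IsIsolatedFlat P) (hv : AnalyticAt ℂ v 0)
    (h : IsFlatEigen P v c) (hμ : deriv v 0 ≠ 0) : ¬ 0 < c := by
  intro hc
  have hv0 := h.map_zero_eq_zero hP hv
  have hre := h.re_deriv_eq_zero hP hv
  obtain ⟨φ, hφ, hlin⟩ := exists_linearization hv hv0 hμ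
  set μ := deriv v 0 with hμdef
  have hμI : μ = Complex.I * μ.im := by
    apply Complex.ext <;> simp [hre]
  have him : μ.im ≠ 0 := fun h0 => hμ (by rw [hμI, h0]; simp)
  have himC : (μ.im : ℂ) ≠ 0 := by exact_mod_cast him
  obtain ⟨C, hC0, δ, hδ, hb⟩ := h.exists_bound hP 1
  obtain ⟨δ', hδ', hδδ', hCδ'⟩ : ∃ δ' > 0, δ' ≤ δ ∧ C * δ' ≤ c / 2 := by
    refine ⟨min δ (c / 2 / (C + 1)), lt_min hδ (by positivity), min_le_left _ _, ?_⟩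
    calc C * min δ (c / 2 / (C + 1)) ≤ (C + 1) * (c / 2 / (C + 1)) := by
          gcongr
          · linarith
          · exact min_le_right _ _
      _ = c / 2 := by field_simp
  refine hP.not_eventually_eq_zero ?_
  rw [← hφ.map_nhds, eventually_map]
  obtain ⟨η, hη, hηb⟩ := Metric.eventually_nhds_iff_ball.1
    ((hlin.and hφ.holomorphic.eventually_analyticAt).and
      (hφ.tendsto.eventually (Metric.ball_mem_nhds 0 hδ')))
  filter_upwards [Metric.ball_mem_nhds 0 hη] with w₀ hw₀
  have hmem : ∀ t : ℝ, w₀ * Complex.exp (μ * t) ∈ Metric.ball (0 : ℂ) η := fun t => by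
    rw [mem_ball_zero_iff] at *
    exact (norm_mul_exp_le (by simp [hre])).trans_lt hw₀
  set T := 2 * Real.pi / |μ.im| with hT
  have hT0 : 0 < T := by positivity
  have hper : Complex.exp (μ * T) = 1 := by
    rw [hμI, hT, Complex.exp_eq_one_iff]
    rcases abs_choice μ.im with h1 | h1 <;> rw [h1]
    · refine ⟨1, ?_⟩
      push_cast
      field_simp
    · refine ⟨-1, ?_⟩
      push_cast
      field_simp
  have := sq_mul_exp_le_of_integralCurve (z := fun t => φ (w₀ * Complex.exp (μ * t)))
      (c := c) hT0.le hb (fun t _ => Metric.ball_subset_ball hδδ' (hηb _ (hmem t)).2)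
      (fun t _ => hasDerivWithinAt_linearized (hηb _ (hmem t)).1.2.differentiableAt
        (hηb _ (hmem t)).1.1)
      (A := fun s => (-c) * s) (A' := fun _ => -c)
      (fun s _ => by simpa using ((hasDerivAt_id s).const_mul (-c)).hasDerivWithinAt)
      (fun s _ => by
        have h1 := mem_ball_zero_iff.1 (hηb _ (hmem s)).2
        have h2 := mul_le_mul_of_nonneg_left h1.le hC0
        rw [pow_one]
        linarith)
  simp only [mul_zero, Real.exp_zero, mul_one, Complex.ofReal_zero, Complex.exp_zero, hper] at this
  have hexp : Real.exp (-c * T) < 1 := Real.exp_lt_one_iff.2 (by nlinarith)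
  by_contra hne
  have hpos : 0 < P (φ w₀) ^ 2 := by positivity
  nlinarith

theorem eq_zero_of_deriv_ne_zero (hP : IsIsolatedFlat P) (hv : AnalyticAt ℂ v 0)
    (h : IsFlatEigen P v c) (hμ : deriv v 0 ≠ 0) : c = 0 := by
  refine le_antisymm (not_lt.1 (h.not_pos_of_deriv_ne_zero hP hv hμ)) (not_lt.1 fun hc => ?_)
  refine h.neg.not_pos_of_deriv_ne_zero hP hv.neg ?_ (by linarith)
  rw [deriv.neg]
  simpa using hμ

theorem eq_zero_of_eventually_eq_zero (hP : IsIsolatedFlat P) (h : IsFlatEigen P v c)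
    (hv : ∀ᶠ z in 𝓝 0, v z = 0) : c = 0 := by
  by_contra hc
  obtain ⟨C, hC0, hC⟩ := (h 1).exists_nonneg
  refine hP.not_eventually_eq_zero ?_
  have hsmall : ∀ᶠ z : ℂ in 𝓝 0, C * ‖z‖ < |c| := by
    have : Tendsto (fun z : ℂ => C * ‖z‖) (𝓝 0) (𝓝 (C * ‖(0 : ℂ)‖)) :=
      (continuous_const.mul continuous_norm).tendsto 0
    exact this.eventually_lt_const (by simpa using hc)
  filter_upwards [hv, hC.bound, hsmall] with z h1 h2 h3
  by_contra hne
  have hpos : 0 < |P z| := abs_pos.2 hne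
  simp only [h1, map_zero, zero_sub, norm_neg, norm_mul, Real.norm_eq_abs, pow_one, abs_norm] at h2
  nlinarith

end IsFlatEigen

/-! ### Vector fields with a multiple zero -/

/-- A vector field close to `1` on a half-plane has integral curves that stay in the half-plane for
an arbitrarily long positive time. -/
theorem exists_integralCurve_halfPlane {W : ℂ → ℂ} {R T : ℝ} {K : NNReal} {s₀ : ℂ} (hT : 0 ≤ T)
    (hW : LipschitzOnWith K W {s | R ≤ s.re}) (hW1 : ∀ s : ℂ, R ≤ s.re → ‖W s - 1‖ ≤ 1 / 2)
    (hs₀ : R ≤ s₀.re) :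
    ∃ α : ℝ → ℂ, α 0 = s₀ ∧ ∀ t ∈ Icc 0 T, R + t / 2 ≤ (α t).re ∧
      HasDerivWithinAt α (W (α t)) (Icc 0 T) t := by
  -- The field is extended to the plane by composing it with the projection to the half-plane.
  set π : ℂ → ℂ := fun s => ⟨max s.re R, s.im⟩ with hπ
  have hπmem : ∀ s, π s ∈ {s : ℂ | R ≤ s.re} := fun s => le_max_right s.re R
  have hπid : ∀ s : ℂ, R ≤ s.re → π s = s := fun s hs => by
    apply Complex.ext
    · exact max_eq_left hs
    · rfl
  have hπlip : LipschitzWith 1 π := LipschitzWith.of_dist_le_mul fun x y => by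
    rw [NNReal.coe_one, one_mul, Complex.dist_eq_re_im, Complex.dist_eq_re_im]
    refine Real.sqrt_le_sqrt (add_le_add_left ?_ _)
    exact sq_le_sq.2 (abs_max_sub_max_le_abs _ _ _)
  have hlip : LipschitzWith K (W ∘ π) := by
    have := hW.comp (hπlip.lipschitzOnWith (s := univ)) fun s _ => hπmem s
    rwa [mul_one, lipschitzOnWith_univ] at this
  have hnorm : ∀ s, ‖(W ∘ π) s‖ ≤ 2 := fun s => by
    have h1 := norm_sub_norm_le (W (π s)) 1
    have h2 := hW1 _ (hπmem s)
    rw [norm_one] at h1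
    simp only [Function.comp_apply]
    linarith
  have hre : ∀ s, 1 / 2 ≤ ((W ∘ π) s).re := fun s => by
    have h1 := (Complex.abs_re_le_norm _).trans (hW1 _ (hπmem s))
    rw [Complex.sub_re, Complex.one_re, abs_le] at h1
    simp only [Function.comp_apply]
    linarith
  obtain ⟨α, hα0, hα⟩ := (IsPicardLindelof.of_time_independent (f := W ∘ π) (tmin := 0)
    (tmax := T) (t₀ := ⟨0, le_rfl, hT⟩) (x₀ := s₀) (a := 2 * T.toNNReal) (r := 0) (L := 2) (K := K)
    (fun s _ => hnorm s) hlip.lipschitzOnWith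
    (by simp [hT])).exists_eq_forall_mem_Icc_hasDerivWithinAt₀
  have hαre : ∀ t ∈ Icc 0 T, R + t / 2 ≤ (α t).re := fun t ht => by
    have hd : ∀ t ∈ Icc 0 T, HasDerivWithinAt (fun t => (α t).re - t / 2)
        (((W ∘ π) (α t)).re - 1 / 2) (Icc 0 T) t := fun t ht =>
      (Complex.reCLM.hasFDerivAt.comp_hasDerivWithinAt t (hα t ht)).sub
        ((hasDerivAt_id t).div_const 2).hasDerivWithinAt
    have := monotoneOn_mul_exp hd (A := fun _ => 0) (A' := fun _ => 0)
      (fun t _ => hasDerivWithinAt_const _ _ _) (fun t _ => by linarith [hre (α t)])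
      (left_mem_Icc.2 hT) ht ht.1
    simp only [Real.exp_zero, mul_one, zero_div, sub_zero] at this
    have h0 : α 0 = s₀ := hα0
    rw [h0] at this
    linarith
  refine ⟨α, hα0, fun t ht => ⟨hαre t ht, ?_⟩⟩
  have := hα t ht
  rwa [Function.comp_apply, hπid _ (by linarith [hαre t ht, ht.1])] at this

/-- On the right half-plane, the model equation `Z' = b Z ^ (n + 1)` has the solution
`Z(s) = (-n b s) ^ (-1 / n)`. -/
theorem exists_model_solution {n : ℕ} (hn : n ≠ 0) {b : ℂ} (hb : b ≠ 0) :
    ∃ (Z : ℂ → ℂ), ∃ a > 0, ∀ s : ℂ, 0 < s.re → Z s ≠ 0 ∧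
      HasDerivAt Z (b * Z s ^ (n + 1)) s ∧ ‖Z s‖ ^ n * ‖s‖ = a := by
  have hnC : (n : ℂ) ≠ 0 := Nat.cast_ne_zero.2 hn
  obtain ⟨κ, hκ⟩ := IsAlgClosed.exists_pow_nat_eq (-1 / (n * b)) (Nat.pos_of_ne_zero hn)
  have hκ0 : κ ≠ 0 := by
    rintro rfl
    rw [zero_pow hn, eq_comm, div_eq_zero_iff] at hκ
    simp [hb, hn] at hκ
  refine ⟨fun s => κ * s ^ (-1 / n : ℂ), ‖κ‖ ^ n, by positivity, fun s hs => ?_⟩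
  have hs0 : s ≠ 0 := by
    rintro rfl
    simp at hs
  have hpow : (κ * s ^ (-1 / n : ℂ)) ^ n = κ ^ n / s := by
    rw [mul_pow, ← Complex.cpow_nat_mul, mul_div_cancel₀ _ hnC, Complex.cpow_neg_one]
    rfl
  refine ⟨mul_ne_zero hκ0 (by simp [Complex.cpow_eq_zero_iff, hs0]), ?_, ?_⟩
  · refine ((Complex.hasStrictDerivAt_cpow_const (Or.inl hs)).hasDerivAt.const_mul κ).congr_deriv ?_
    rw [pow_succ, hpow, hκ, Complex.cpow_sub _ _ hs0, Complex.cpow_one]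
    field_simp
  · rw [← norm_pow, hpow, norm_div, norm_pow, div_mul_cancel₀ _ (norm_ne_zero_iff.2 hs0)]

namespace IsFlatEigen

variable {P : ℂ → ℝ} {v : ℂ → ℂ} {c : ℝ}

/-- In the coordinate `s` with `z = Z(s)`, a field `v` with a multiple zero is close to `∂_s` on a
half-plane. Its integral curves tend to the origin so fast that `P`, which decays no faster than
the integrable flat error term allows, cannot tend to `0` along them unless it vanishes on the
whole image of the half-plane. -/
theorem not_nonneg_of_multiple_zero (hP : IsIsolatedFlat P) (h : IsFlatEigen P v c) {n : ℕ}
    (hn : n ≠ 0) {g : ℂ → ℂ} (hg : AnalyticAt ℂ g 0) (hg0 : g 0 ≠ 0)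
    (hvg : ∀ᶠ z in 𝓝 0, v z = z ^ (n + 1) * g z) : ¬ 0 ≤ c := by
  intro hc
  obtain ⟨Z, a, ha, hZ⟩ := exists_model_solution hn hg0
  obtain ⟨C, hC0, δ₁, hδ₁, hb⟩ := h.exists_bound hP (2 * n)
  obtain ⟨r, hr, hiso⟩ := hP.isolated
  obtain ⟨K₀, hK₀⟩ := (hP.flat n).bound
  have hg1 : ∀ᶠ z in 𝓝 0, ‖g z / g 0 - 1‖ < 1 / 2 := by
    have : Tendsto (fun z => ‖g z / g 0 - 1‖) (𝓝 0) (𝓝 ‖g 0 / g 0 - 1‖) :=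
      ((hg.continuousAt.div_const (g 0)).sub continuousAt_const).norm
    refine this.eventually_lt_const ?_
    simp [hg0]
  have hg' : ∀ᶠ z in 𝓝 0, ‖deriv g z‖ < ‖deriv g 0‖ + 1 :=
    hg.deriv.continuousAt.norm.eventually_lt_const (by linarith)
  have hnhds₁ : ∀ᶠ z in 𝓝 (0 : ℂ), z ∈ Metric.ball (0 : ℂ) δ₁ := Metric.ball_mem_nhds _ hδ₁
  have hnhdsr : ∀ᶠ z in 𝓝 (0 : ℂ), z ∈ Metric.ball (0 : ℂ) r := Metric.ball_mem_nhds _ hr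
  obtain ⟨δ, hδ, hδb⟩ := Metric.eventually_nhds_iff_ball.1
    ((hnhds₁.and (hnhdsr.and hK₀)).and ((hg1.and hg').and (hg.eventually_analyticAt.and hvg)))
  have hZsmall : ∀ ε > 0, ∃ R ≥ 1, ∀ s : ℂ, R ≤ s.re → ‖Z s‖ < ε := fun ε hε => by
    refine ⟨a / ε ^ n + 1, by linarith [show 0 < a / ε ^ n by positivity], fun s hs => ?_⟩
    have h1 : 0 < a / ε ^ n := by positivity
    have h2 : s.re ≤ ‖s‖ := Complex.re_le_norm s
    have h3 : a / ε ^ n < ‖s‖ := by linarith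
    obtain ⟨-, -, h4⟩ := hZ s (by linarith)
    refine lt_of_pow_lt_pow_left₀ n hε.le ?_
    rw [div_lt_iff₀ (by positivity), ← h4] at h3
    exact lt_of_mul_lt_mul_right (by linarith) (norm_nonneg s)
  obtain ⟨R, hR1, hR⟩ := hZsmall δ hδ
  have hZb : ∀ s : ℂ, R ≤ s.re → Z s ∈ Metric.ball (0 : ℂ) δ := fun s hs =>
    mem_ball_zero_iff.2 (hR s hs)
  set W : ℂ → ℂ := fun s => g (Z s) / g 0 with hWdef
  have hWd : ∀ s : ℂ, R ≤ s.re →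
      HasDerivAt W (deriv g (Z s) * (g 0 * Z s ^ (n + 1)) / g 0) s := fun s hs =>
    ((hδb _ (hZb s hs)).2.2.1.differentiableAt.hasDerivAt.comp s
      (hZ s (by linarith)).2.1).div_const _
  have hconv : Convex ℝ {s : ℂ | R ≤ s.re} := convex_halfSpace_re_ge R
  set K : ℝ := (‖deriv g 0‖ + 1) * δ ^ (n + 1) with hK
  have hWlip : LipschitzOnWith K.toNNReal W {s | R ≤ s.re} := by
    refine hconv.lipschitzOnWith_of_nnnorm_hasDerivWithin_le
      (fun s hs => (hWd s hs).hasDerivWithinAt) fun s hs => ?_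
    rw [← NNReal.coe_le_coe, coe_nnnorm, Real.coe_toNNReal _ (by positivity)]
    rw [show deriv g (Z s) * (g 0 * Z s ^ (n + 1)) / g 0 = deriv g (Z s) * Z s ^ (n + 1) by
      field_simp, norm_mul, norm_pow]
    have h1 := (hδb _ (hZb s hs)).2.1.2.le
    exact mul_le_mul h1 (pow_le_pow_left₀ (norm_nonneg _) (hR s hs).le _) (by positivity)
      (by positivity)
  have hzero : ∀ s₀ : ℂ, R ≤ s₀.re → P (Z s₀) = 0 := fun s₀ hs₀ => by
    -- Along the curve, `2 * C * ‖z‖ ^ (2 * n)` is at most `k / (1 + t) ^ 2`, with primitive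
    -- `-k / (1 + t)`.
    set k : ℝ := 8 * C * a ^ 2 with hk
    have hmain : ∀ T : ℝ, 0 ≤ T →
        P (Z s₀) ^ 2 * Real.exp (-k) ≤ (K₀ * (2 * a)) ^ 2 * (1 / (1 + T)) := fun T hT => by
      obtain ⟨α, hα0, hα⟩ := exists_integralCurve_halfPlane hT hWlip
        (fun s hs => (hδb _ (hZb s hs)).2.1.1.le) hs₀
      have hαR : ∀ t ∈ Icc 0 T, R ≤ (α t).re := fun t ht => by linarith [(hα t ht).1, ht.1]
      have hZα : ∀ t ∈ Icc 0 T, ‖Z (α t)‖ ^ n ≤ 2 * a / (1 + t) := fun t ht => by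
        have h1 := (hZ (α t) (by linarith [hαR t ht])).2.2
        have h2 := (Complex.re_le_norm (α t))
        have h3 := (hα t ht).1
        have h4 : 0 ≤ ‖Z (α t)‖ ^ n := by positivity
        have ht0 := ht.1
        rw [le_div_iff₀ (by linarith)]
        nlinarith
      have hcurve : ∀ t ∈ Icc 0 T,
          HasDerivWithinAt (fun t => Z (α t)) (v (Z (α t))) (Icc 0 T) t := fun t ht => by
        have h1 := (hZ (α t) (by linarith [hαR t ht])).2.1
        have h2 := (h1.hasFDerivAt.restrictScalars ℝ).comp_hasDerivWithinAt t (hα t ht).2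
        refine h2.congr_deriv ?_
        rw [(hδb _ (hZb _ (hαR t ht))).2.2.2]
        simp only [ContinuousLinearMap.coe_restrictScalars', ContinuousLinearMap.toSpanSingleton_apply,
          smul_eq_mul, hWdef]
        field_simp
      have hsq := sq_mul_exp_le_of_integralCurve (z := fun t => Z (α t)) (c := c) hT hb
        (fun t ht => (hδb _ (hZb _ (hαR t ht))).1.1) hcurve
        (A := fun t => -k / (1 + t)) (A' := fun t => k / (1 + t) ^ 2)
        (fun t ht => by
          have ht0 : (1 + t) ≠ 0 := by linarith [ht.1]
          exact (((hasDerivAt_const t (-k)).div ((hasDerivAt_id t).const_add 1) ht0).congr_deriv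
            (by simp)).hasDerivWithinAt)
        (fun t ht => by
          have ht0 := ht.1
          have h1 : (‖Z (α t)‖ ^ n) ^ 2 ≤ (2 * a / (1 + t)) ^ 2 := by
            have := hZα t ht
            gcongr
          calc 2 * C * ‖Z (α t)‖ ^ (2 * n) = 2 * C * (‖Z (α t)‖ ^ n) ^ 2 := by
                rw [← pow_mul, mul_comm n]
            _ ≤ 2 * C * (2 * a / (1 + t)) ^ 2 := by gcongr
            _ = k / (1 + t) ^ 2 := by rw [hk, div_pow]; ring
            _ ≤ k / (1 + t) ^ 2 + 2 * c := by linarith)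
      simp only [hα0, add_zero, div_one] at hsq
      refine hsq.trans ?_
      have hTm : T ∈ Icc 0 T := right_mem_Icc.2 hT
      have h1 := (hδb _ (hZb _ (hαR T hTm))).1.2.2
      rw [norm_pow, norm_norm, Real.norm_eq_abs] at h1
      have hZn : 0 < ‖Z (α T)‖ ^ n := by
        have := (hZ (α T) (by linarith [hαR T hTm])).1
        positivity
      have hK₀0 : 0 ≤ K₀ := nonneg_of_mul_nonneg_left ((abs_nonneg _).trans h1) hZn
      have h2 : |P (Z (α T))| ≤ K₀ * (2 * a / (1 + T)) := by
        have := hZα T hTm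
        exact h1.trans (by gcongr)
      have hk0 : 0 ≤ k := by positivity
      have h3 : Real.exp (-k / (1 + T)) ≤ 1 := by
        rw [Real.exp_le_one_iff, neg_div, neg_nonpos]
        positivity
      calc P (Z (α T)) ^ 2 * Real.exp (-k / (1 + T)) ≤ P (Z (α T)) ^ 2 * 1 := by gcongr
        _ = |P (Z (α T))| ^ 2 := by rw [mul_one, sq_abs]
        _ ≤ (K₀ * (2 * a / (1 + T))) ^ 2 := by gcongr
        _ = (K₀ * (2 * a)) ^ 2 * (1 / (1 + T)) * (1 / (1 + T)) := by ring
        _ ≤ (K₀ * (2 * a)) ^ 2 * (1 / (1 + T)) * 1 := by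
          gcongr
          rw [div_le_one (by linarith)]
          linarith
        _ = _ := mul_one _
    have hlim : Tendsto (fun T : ℝ => (K₀ * (2 * a)) ^ 2 * (1 / (1 + T))) atTop
        (𝓝 ((K₀ * (2 * a)) ^ 2 * 0)) := by
      refine tendsto_const_nhds.mul ?_
      simp only [one_div]
      exact tendsto_inv_atTop_zero.comp (tendsto_atTop_add_const_left _ _ tendsto_id)
    have hle := ge_of_tendsto hlim ((eventually_ge_atTop 0).mono hmain)
    rw [mul_zero] at hle
    have h1 : P (Z s₀) ^ 2 ≤ 0 := nonpos_of_mul_nonpos_left hle (Real.exp_pos _)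
    exact pow_eq_zero_iff two_ne_zero |>.1 (le_antisymm h1 (sq_nonneg _))
  set S := Z '' {s : ℂ | R ≤ s.re} with hS
  have hSpre : IsPreconnected S := hconv.isPreconnected.image _ fun s hs =>
    (hZ s (by linarith [show R ≤ s.re from hs])).2.1.continuousAt.continuousWithinAt
  have h0S : (0 : ℂ) ∈ closure S := by
    refine Metric.mem_closure_iff.2 fun ε hε => ?_
    obtain ⟨R', hR'1, hR'⟩ := hZsmall ε hε
    refine ⟨Z (max R R' : ℝ), ⟨_, by simp, rfl⟩, ?_⟩
    rw [dist_zero_left]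
    exact hR' _ (by simp)
  have hsub := hiso (insert 0 S)
    (insert_subset (Metric.mem_ball_self hr) (by
      rintro _ ⟨s, hs, rfl⟩
      exact (hδb _ (hZb s hs)).1.2.1))
    (hSpre.subset_closure (subset_insert _ _) (insert_subset h0S subset_closure))
    (mem_insert _ _) (by
      rintro z (rfl | ⟨s, hs, rfl⟩)
      · exact hP.map_zero
      · exact hzero s hs)
  have hRR : R ≤ ((R : ℝ) : ℂ).re := le_of_eq (by simp)
  exact (hZ (R : ℂ) (by linarith)).1 (hsub (mem_insert_of_mem _ ⟨_, hRR, rfl⟩))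

/-- The dichotomy: a holomorphic field along which `P` is an eigenvector up to flat errors vanishes
identically as soon as its linear part does. -/
theorem eventually_eq_zero_of_deriv_eq_zero (hP : IsIsolatedFlat P) (hv : AnalyticAt ℂ v 0)
    (h : IsFlatEigen P v c) (hμ : deriv v 0 = 0) : ∀ᶠ z in 𝓝 0, v z = 0 := by
  by_contra hne
  obtain ⟨k, g, hg, hg0, hvg⟩ := hv.exists_eventuallyEq_pow_smul_nonzero_iff.2 hne
  simp only [sub_zero, smul_eq_mul] at hvg
  match k, hvg with
  | 0, hvg =>
    have h1 := hvg.self_of_nhds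
    rw [h.map_zero_eq_zero hP hv, pow_zero, one_mul] at h1
    exact hg0 h1.symm
  | 1, hvg =>
    have h1 : HasDerivAt (fun z => z ^ 1 * g z) (g 0) 0 :=
      (((hasDerivAt_id (0 : ℂ)).pow 1).mul hg.differentiableAt.hasDerivAt).congr_deriv (by simp)
    rw [EventuallyEq.deriv_eq hvg, h1.deriv] at hμ
    exact hg0 hμ
  | n + 2, hvg =>
    rcases le_total 0 c with hc | hc
    · exact h.not_nonneg_of_multiple_zero hP n.succ_ne_zero hg hg0 hvg hc
    · refine h.neg.not_nonneg_of_multiple_zero hP n.succ_ne_zero hg.neg (neg_ne_zero.2 hg0) ?_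
        (neg_nonneg.2 hc)
      filter_upwards [hvg] with z hz
      rw [hz, Pi.neg_apply, mul_neg]

theorem eigenvalue_eq_zero (hP : IsIsolatedFlat P) (hv : AnalyticAt ℂ v 0)
    (h : IsFlatEigen P v c) : c = 0 := by
  by_cases hμ : deriv v 0 = 0
  · exact h.eq_zero_of_eventually_eq_zero hP (h.eventually_eq_zero_of_deriv_eq_zero hP hv hμ)
  · exact h.eq_zero_of_deriv_ne_zero hP hv hμ

end IsFlatEigen

/-! ### The tangency equation on the slices `Im z₁ = t` -/

theorem fderiv_rho {P : ℂ → ℝ} {z : ℂ × ℂ} (hP : DifferentiableAt ℝ P z.2) (w : ℂ × ℂ) :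
    fderiv ℝ (rho P) z w = w.1.re + fderiv ℝ P z.2 w.2 := by
  have h1 : HasFDerivAt (fun z : ℂ × ℂ => z.1.re)
      (Complex.reCLM.comp (ContinuousLinearMap.fst ℝ ℂ ℂ)) z :=
    (Complex.reCLM.comp (ContinuousLinearMap.fst ℝ ℂ ℂ)).hasFDerivAt
  have h2 : HasFDerivAt (fun z : ℂ × ℂ => P z.2)
      ((fderiv ℝ P z.2).comp (ContinuousLinearMap.snd ℝ ℂ ℂ)) z :=
    hP.hasFDerivAt.comp z hasFDerivAt_snd
  have h3 : HasFDerivAt (rho P) _ z := h1.add h2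
  rw [h3.fderiv]
  simp

theorem reApply_rho {P : ℂ → ℝ} {z : ℂ × ℂ} (hP : DifferentiableAt ℝ P z.2)
    (H : ℂ × ℂ → ℂ × ℂ) :
    reApply H (rho P) z = ((H z).1.re + fderiv ℝ P z.2 (H z).2) / 2 := by
  have h1 : fderiv ℝ P z.2 (H z).2 =
      (H z).2.re * fderiv ℝ P z.2 1 + (H z).2.im * fderiv ℝ P z.2 Complex.I := by
    conv_lhs => rw [show (H z).2 = (H z).2.re • (1 : ℂ) + (H z).2.im • Complex.I by
      simp [Complex.re_add_im]]
    rw [map_add, map_smul, map_smul, smul_eq_mul, smul_eq_mul]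
  rw [h1, reApply, dz₁, dz₂]
  simp only [fderiv_rho hP]
  simp
  ring

/-- The tangency condition at the points `(it - P(z), z)` of the hypersurface. -/
theorem IsTangent.eventually_eq {P : ℂ → ℝ} (hP : IsIsolatedFlat P) {H : ℂ × ℂ → ℂ × ℂ}
    (hH : IsTangent P H) :
    ∀ᶠ t : ℝ in 𝓝 0, ∀ᶠ z in 𝓝 (0 : ℂ), (H (Complex.I * t - P z, z)).1.re +
      fderiv ℝ P z (H (Complex.I * t - P z, z)).2 = 0 := by
  have hs : Tendsto (fun q : ℝ × ℂ => q.2) (𝓝 0 ×ˢ 𝓝 0) (𝓝 0) := tendsto_snd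
  have hPq : Tendsto (fun q : ℝ × ℂ => (P q.2 : ℂ)) (𝓝 0 ×ˢ 𝓝 0) (𝓝 0) := by
    have h1 : Tendsto (fun x : ℝ => (x : ℂ)) (𝓝 0) (𝓝 0) := by
      simpa using Complex.continuous_ofReal.tendsto 0
    exact h1.comp (hP.tendsto.comp hs)
  have ht : Tendsto (fun q : ℝ × ℂ => Complex.I * q.1) (𝓝 0 ×ˢ 𝓝 0) (𝓝 0) := by
    have h1 : Tendsto (fun x : ℝ => Complex.I * (x : ℂ)) (𝓝 0) (𝓝 0) := by
      have : Continuous fun x : ℝ => Complex.I * (x : ℂ) := by fun_prop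
      simpa using this.tendsto 0
    exact h1.comp tendsto_fst
  have hlim : Tendsto (fun q : ℝ × ℂ => (Complex.I * q.1 - P q.2, q.2)) (𝓝 0 ×ˢ 𝓝 0) (𝓝 0) := by
    have := (ht.sub hPq).prodMk_nhds hs
    rwa [sub_zero, Prod.mk_zero_zero] at this
  have hev : ∀ᶠ q : ℝ × ℂ in 𝓝 0 ×ˢ 𝓝 0, (H (Complex.I * q.1 - P q.2, q.2)).1.re +
      fderiv ℝ P q.2 (H (Complex.I * q.1 - P q.2, q.2)).2 = 0 := by
    filter_upwards [hlim.eventually hH, hs.eventually hP.differentiable] with q h1 h2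
    have h3 := h1 (by simp [hypersurface, rho])
    rw [reApply_rho h2] at h3
    linarith
  exact hev.curry

section Slice

variable {P : ℂ → ℝ} {h₁ h₂ : ℂ × ℂ → ℂ} {a : ℂ}

theorem tendsto_shift (hP : IsIsolatedFlat P) (a : ℂ) :
    Tendsto (fun z : ℂ => a - P z) (𝓝 0) (𝓝 a) := by
  have h1 : Tendsto (fun z : ℂ => a - (P z : ℂ)) (𝓝 0) (𝓝 (a - ((0 : ℝ) : ℂ))) :=
    tendsto_const_nhds.sub ((Complex.continuous_ofReal.tendsto 0).comp hP.tendsto)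
  simpa using h1

theorem shift_sub_isBigO (hP : IsIsolatedFlat P) {h : ℂ × ℂ → ℂ} (hh : AnalyticAt ℂ h (a, 0)) :
    (fun z => h (a - P z, z) - h (a, z)) =O[𝓝 0] P := by
  have ht : Tendsto (fun z : ℂ => ((a - (P z : ℂ), z), (a, z))) (𝓝 0) (𝓝 ((a, 0), (a, 0))) :=
    ((tendsto_shift hP a).prodMk_nhds tendsto_id).prodMk_nhds
      (tendsto_const_nhds.prodMk_nhds tendsto_id)
  refine (hh.hasStrictFDerivAt.isBigO_sub.comp_tendsto ht).trans ?_
  refine IsBigO.of_bound 1 (Eventually.of_forall fun z => ?_)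
  simp [Prod.norm_def]

theorem re_isBigO {u : ℂ → ℂ} : (fun z => (u z).re) =O[𝓝 0] u :=
  IsBigO.of_bound 1 (Eventually.of_forall fun z => by
    simpa using Complex.abs_re_le_norm (u z))

theorem fderiv_apply_isBigO {u : ℂ → ℂ} :
    (fun z => fderiv ℝ P z (u z)) =O[𝓝 0] fun z => ‖fderiv ℝ P z‖ * ‖u z‖ :=
  IsBigO.of_bound 1 (Eventually.of_forall fun z => by
    simpa using (fderiv ℝ P z).le_opNorm (u z))

/-- As `P` is flat, the real part of `h₁` on a slice is flat, hence zero. -/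
theorem slice_eq_const (hP : IsIsolatedFlat P) (hh₁ : AnalyticAt ℂ h₁ (a, 0))
    (hh₂ : AnalyticAt ℂ h₂ (a, 0))
    (h : ∀ᶠ z in 𝓝 (0 : ℂ), (h₁ (a - P z, z)).re + fderiv ℝ P z (h₂ (a - P z, z)) = 0) :
    (h₁ (a, 0)).re = 0 ∧ ∀ᶠ z in 𝓝 (0 : ℂ), h₁ (a, z) = h₁ (a, 0) := by
  refine eventually_eq_of_re_isBigO_pow (f := fun z => h₁ (a, z))
    (hh₁.comp₂ analyticAt_const analyticAt_id) fun N => ?_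
  have ht : Tendsto (fun z : ℂ => (a - (P z : ℂ), z)) (𝓝 0) (𝓝 (a, 0)) :=
    (tendsto_shift hP a).prodMk_nhds tendsto_id
  have h1 : (fun z => (h₁ (a - P z, z) - h₁ (a, z)).re) =O[𝓝 0] fun z : ℂ => ‖z‖ ^ N :=
    re_isBigO.trans ((shift_sub_isBigO hP hh₁).trans (hP.flat N))
  have h2 : (fun z => fderiv ℝ P z (h₂ (a - P z, z))) =O[𝓝 0] fun z : ℂ => ‖z‖ ^ N := by
    refine fderiv_apply_isBigO.trans ?_
    have h3 := (hP.fderiv_flat N).norm_left.mul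
      ((hh₂.continuousAt.tendsto.comp ht).isBigO_one ℝ).norm_left
    simpa using h3
  refine (h1.add h2).neg_left.congr' ?_ .rfl
  filter_upwards [h] with z hz
  rw [Complex.sub_re]
  linarith

/-- The first-order expansion in `P` of the tangency equation on a slice. -/
theorem slice_isFlatEigen (hP : IsIsolatedFlat P) {g : ℂ → ℂ} (hg : AnalyticAt ℂ g a)
    (hga : (g a).re = 0) (hh₂ : AnalyticAt ℂ h₂ (a, 0))
    (h : ∀ᶠ z in 𝓝 (0 : ℂ), (g (a - P z)).re + fderiv ℝ P z (h₂ (a - P z, z)) = 0) :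
    IsFlatEigen P (fun z => h₂ (a, z)) (deriv g a).re := fun N => by
  have hd : DifferentiableAt ℂ (dslope g a) a := by
    obtain ⟨p, hp⟩ := hg
    exact hp.has_fpower_series_dslope_fslope.analyticAt.differentiableAt
  have h1 : (fun z => g (a - P z) - g a + P z * deriv g a) =O[𝓝 0] fun z => P z * ‖z‖ ^ N := by
    have h2 := hd.isBigO_sub.comp_tendsto (tendsto_shift hP a)
    have h3 : (fun z => dslope g a (a - P z) - deriv g a) =O[𝓝 0] fun z => ‖z‖ ^ N := by
      refine IsBigO.trans ?_ (hP.flat N)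
      refine (h2.congr_left fun z => ?_).trans
        (IsBigO.of_bound 1 (Eventually.of_forall fun z => ?_))
      · simp
      · simp
    have h4 : (fun z => -(P z : ℂ)) =O[𝓝 0] P :=
      IsBigO.of_bound 1 (Eventually.of_forall fun z => by simp)
    refine (h4.mul h3).congr_left fun z => ?_
    have h5 := sub_smul_dslope g a (a - P z)
    rw [smul_eq_mul] at h5
    linear_combination h5
  have h2 : (fun z => fderiv ℝ P z (h₂ (a - P z, z) - h₂ (a, z))) =O[𝓝 0]
      fun z => P z * ‖z‖ ^ N := by
    refine fderiv_apply_isBigO.trans ?_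
    exact ((hP.fderiv_flat N).norm_left.mul (shift_sub_isBigO hP hh₂).norm_left).congr_right
      fun z => mul_comm _ _
  have h3 : (fun z => (g (a - P z) - g a + P z * deriv g a).re) =O[𝓝 0]
      fun z => P z * ‖z‖ ^ N :=
    re_isBigO.trans h1
  refine (h3.add h2).neg_left.congr' ?_ .rfl
  filter_upwards [h] with z hz
  rw [Complex.add_re, Complex.sub_re, hga, Complex.re_ofReal_mul, map_sub]
  linarith

end Slice

theorem tendsto_I_mul : Tendsto (fun t : ℝ => Complex.I * t) (𝓝 0) (𝓝 0) := by
  have : Continuous fun t : ℝ => Complex.I * (t : ℂ) := by fun_prop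
  simpa using this.tendsto 0

theorem tendsto_I_mul_prodMk :
    Tendsto (fun t : ℝ => (Complex.I * t, (0 : ℂ))) (𝓝 0) (𝓝 0) := by
  have := tendsto_I_mul.prodMk_nhds (tendsto_const_nhds (x := (0 : ℂ)))
  rwa [Prod.mk_zero_zero] at this

theorem hasDerivAt_comp_I_mul {g : ℂ → ℂ} {t : ℝ} (hg : DifferentiableAt ℂ g (Complex.I * t)) :
    HasDerivAt (fun s : ℝ => g (Complex.I * s)) (deriv g (Complex.I * t) * Complex.I) t := by
  have h1 : HasDerivAt (fun z : ℂ => g (Complex.I * z))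
      (deriv g (Complex.I * t) * (Complex.I * 1)) (t : ℂ) :=
    HasDerivAt.comp (t : ℂ) hg.hasDerivAt ((hasDerivAt_id (t : ℂ)).const_mul Complex.I)
  simpa using h1.comp_ofReal

/-- A holomorphic germ whose derivative vanishes on the imaginary axis is constant. -/
theorem eventually_eq_of_deriv_eq_zero {g : ℂ → ℂ} (hg : AnalyticAt ℂ g 0)
    (h : ∀ᶠ t : ℝ in 𝓝 0, deriv g (Complex.I * t) = 0) : ∀ᶠ u in 𝓝 0, g u = g 0 := by
  obtain ⟨r, hr, hball⟩ := Metric.eventually_nhds_iff_ball.1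
    ((eventually_eq_zero_of_imaginary_axis hg.deriv h).and hg.eventually_analyticAt)
  filter_upwards [Metric.ball_mem_nhds 0 hr] with u hu
  exact Metric.isOpen_ball.is_const_of_deriv_eq_zero (convex_ball _ _).isPreconnected
    (fun z hz => (hball z hz).2.differentiableAt.differentiableWithinAt)
    (fun z hz => (hball z hz).1) hu (Metric.mem_ball_self hr)

/-- A tangent field has no first component, and its second component satisfies on every slice the
hypothesis of the dichotomy with eigenvalue zero. -/
theorem tangent_slices {P : ℂ → ℝ} (hP : IsIsolatedFlat P) {H : ℂ × ℂ → ℂ × ℂ}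
    (hH : MemAut₀ P H) :
    (∀ᶠ w in 𝓝 0, (H w).1 = 0) ∧
      ∀ᶠ t : ℝ in 𝓝 0, IsFlatEigen P (fun z => (H (Complex.I * t, z)).2) 0 := by
  set h₁ : ℂ × ℂ → ℂ := fun w => (H w).1
  set h₂ : ℂ × ℂ → ℂ := fun w => (H w).2
  have hh₁ : AnalyticAt ℂ h₁ 0 := analyticAt_fst.comp hH.holomorphic
  have hh₂ : AnalyticAt ℂ h₂ 0 := analyticAt_snd.comp hH.holomorphic
  set g : ℂ → ℂ := fun u => h₁ (u, 0)
  have hg : AnalyticAt ℂ g 0 := AnalyticAt.comp₂ (h := h₁) hh₁ analyticAt_id analyticAt_const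
  have hconst : ∀ᶠ t : ℝ in 𝓝 0, (g (Complex.I * t)).re = 0 ∧
      ∀ᶠ z in 𝓝 (0 : ℂ), h₁ (Complex.I * t, z) = g (Complex.I * t) := by
    filter_upwards [hH.tangent.eventually_eq hP,
      tendsto_I_mul_prodMk.eventually hh₁.eventually_analyticAt,
      tendsto_I_mul_prodMk.eventually hh₂.eventually_analyticAt] with t h1 h2 h3
    exact slice_eq_const hP h2 h3 h1
  have hindep : ∀ᶠ w : ℂ × ℂ in 𝓝 0, h₁ w = g w.1 := by
    have hG : AnalyticAt ℂ (fun w : ℂ × ℂ => h₁ w - g w.1) 0 :=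
      hh₁.sub (AnalyticAt.fun_comp (g := g) (by simpa using hg) analyticAt_fst)
    refine (eventually_eq_zero_of_imaginary_slices hG ?_).mono fun w hw => sub_eq_zero.1 hw
    filter_upwards [hconst] with t ht
    filter_upwards [ht.2] with z hz
    exact sub_eq_zero.2 hz
  have heigen : ∀ᶠ t : ℝ in 𝓝 0, IsFlatEigen P (fun z => h₂ (Complex.I * t, z))
      (deriv g (Complex.I * t)).re := by
    filter_upwards [hH.tangent.eventually_eq hP, hconst,
      tendsto_I_mul.eventually hg.eventually_analyticAt,
      tendsto_I_mul_prodMk.eventually hh₂.eventually_analyticAt,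
      tendsto_I_mul_prodMk.eventually hindep.eventually_nhds] with t h1 h2 h3 h4 h5
    refine slice_isFlatEigen hP h3 h2.1 h4 ?_
    have ht : Tendsto (fun z : ℂ => (Complex.I * t - (P z : ℂ), z)) (𝓝 0)
        (𝓝 (Complex.I * t, 0)) := (tendsto_shift hP _).prodMk_nhds tendsto_id
    filter_upwards [h1, ht.eventually h5] with z h6 h7
    rw [← h7]
    exact h6
  have hre : ∀ᶠ t : ℝ in 𝓝 0, (deriv g (Complex.I * t)).re = 0 := by
    filter_upwards [heigen, tendsto_I_mul_prodMk.eventually hh₂.eventually_analyticAt] with t h1 h2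
    exact h1.eigenvalue_eq_zero hP (h2.comp₂ analyticAt_const analyticAt_id)
  have him : ∀ᶠ t : ℝ in 𝓝 0, (deriv g (Complex.I * t)).im = 0 := by
    filter_upwards [hconst.eventually_nhds, tendsto_I_mul.eventually hg.eventually_analyticAt]
      with t h1 h2
    have h3 := Complex.reCLM.hasFDerivAt.comp_hasDerivAt t
      (hasDerivAt_comp_I_mul h2.differentiableAt)
    have h4 : HasDerivAt (fun _ : ℝ => (0 : ℝ)) _ t :=
      h3.congr_of_eventuallyEq (h1.mono fun s hs => hs.1.symm)
    simpa using h4.unique (hasDerivAt_const _ _)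
  refine ⟨?_, ?_⟩
  · have hg0 := eventually_eq_of_deriv_eq_zero hg
      (hre.and him |>.mono fun t ht => Complex.ext ht.1 ht.2)
    have h00 : g 0 = 0 := by
      change (H (0, 0)).1 = 0
      rw [Prod.mk_zero_zero, hH.map_zero, Prod.fst_zero]
    have hfst : Tendsto (fun w : ℂ × ℂ => w.1) (𝓝 0) (𝓝 0) := continuous_fst.tendsto 0
    filter_upwards [hindep, hfst.eventually hg0] with w h1 h2
    exact h1.trans (h2.trans h00)
  · filter_upwards [heigen, hre] with t h1 h2
    rwa [h2] at h1

/-! ### Separation of variables -/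

/-- Two slices of `h₂` are real multiples of each other, because a real combination whose linear
part vanishes is zero by the dichotomy. Hence `h₂` is a product. -/
theorem exists_factorization {P : ℂ → ℝ} (hP : IsIsolatedFlat P) {h : ℂ × ℂ → ℂ}
    (hh : AnalyticAt ℂ h 0)
    (hE : ∀ᶠ t : ℝ in 𝓝 0, IsFlatEigen P (fun z => h (Complex.I * t, z)) 0) :
    (∀ᶠ w in 𝓝 0, h w = 0) ∨
      ∃ F v : ℂ → ℂ, AnalyticAt ℂ F 0 ∧ (∀ᶠ t : ℝ in 𝓝 0, (F (Complex.I * t)).im = 0) ∧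
        AnalyticAt ℂ v 0 ∧ v 0 = 0 ∧ deriv v 0 = Complex.I ∧
        ∀ᶠ w : ℂ × ℂ in 𝓝 0, h w = F w.1 * v w.2 := by
  set F : ℂ → ℂ := fun u => -Complex.I * fderiv ℂ h (u, 0) (0, 1) with hF
  have hFa : AnalyticAt ℂ F 0 := by
    have h1 : AnalyticAt ℂ (fun u : ℂ => fderiv ℂ h (u, 0)) 0 :=
      AnalyticAt.fun_comp (f := fun u : ℂ => (u, (0 : ℂ))) hh.fderiv
        (analyticAt_id.prod analyticAt_const)
    exact analyticAt_const.mul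
      (((ContinuousLinearMap.apply ℂ ℂ ((0, 1) : ℂ × ℂ)).analyticAt _).comp h1)
  have hgood : ∀ᶠ t : ℝ in 𝓝 0, AnalyticAt ℂ (fun z => h (Complex.I * t, z)) 0 ∧
      HasDerivAt (fun z => h (Complex.I * t, z)) (Complex.I * F (Complex.I * t)) 0 := by
    filter_upwards [tendsto_I_mul_prodMk.eventually hh.eventually_analyticAt] with t ht
    refine ⟨ht.comp₂ analyticAt_const analyticAt_id, ?_⟩
    have h1 := ht.differentiableAt.hasFDerivAt.comp_hasDerivAt (0 : ℂ)
      ((hasDerivAt_const (0 : ℂ) (Complex.I * (t : ℂ))).prodMk (hasDerivAt_id (0 : ℂ)))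
    refine h1.congr_deriv ?_
    rw [hF, ← mul_assoc, mul_neg, Complex.I_mul_I, neg_neg, one_mul]
  have hreal : ∀ᶠ t : ℝ in 𝓝 0, (F (Complex.I * t)).im = 0 := by
    filter_upwards [hgood, hE] with t h1 h2
    have h3 := h2.re_deriv_eq_zero hP h1.1
    rw [h1.2.deriv] at h3
    simpa using h3
  by_cases hF0 : ∀ᶠ t : ℝ in 𝓝 0, F (Complex.I * t) = 0
  · refine Or.inl (eventually_eq_zero_of_imaginary_slices hh ?_)
    filter_upwards [hgood, hE, hF0] with t h1 h2 h3
    refine h2.eventually_eq_zero_of_deriv_eq_zero hP h1.1 ?_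
    rw [h1.2.deriv, h3, mul_zero]
  · refine Or.inr ?_
    obtain ⟨t₀, ht₀, hgood₀, hE₀, hreal₀⟩ :=
      ((not_eventually.1 hF0).and_eventually (hgood.and (hE.and hreal))).exists
    set b := (F (Complex.I * t₀)).re with hb
    have hFb : F (Complex.I * t₀) = b := Complex.ext rfl (by simpa using hreal₀)
    have hb0 : b ≠ 0 := fun h0 => ht₀ (by rw [hFb, h0, Complex.ofReal_zero])
    have hbC : (b : ℂ) ≠ 0 := by exact_mod_cast hb0
    set v : ℂ → ℂ := fun z => b⁻¹ • h (Complex.I * t₀, z) with hv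
    have hva : AnalyticAt ℂ v 0 := by
      have : v = fun z => ((b⁻¹ : ℝ) : ℂ) * h (Complex.I * t₀, z) := by
        funext z
        exact Complex.real_smul
      rw [this]
      exact analyticAt_const.mul hgood₀.1
    have hvE : IsFlatEigen P v 0 := by
      have := hE₀.const_smul b⁻¹
      rwa [mul_zero] at this
    have hvd : HasDerivAt v Complex.I 0 := by
      refine (hgood₀.2.const_smul b⁻¹).congr_deriv ?_
      rw [hFb, Complex.real_smul, Complex.ofReal_inv]
      field_simp
    refine ⟨F, v, hFa, hreal, hva, hvE.map_zero_eq_zero hP hva, hvd.deriv, ?_⟩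
    have hG : AnalyticAt ℂ (fun w : ℂ × ℂ => h w - F w.1 * v w.2) 0 :=
      hh.sub ((AnalyticAt.fun_comp (g := F) (by simpa using hFa) analyticAt_fst).mul
        (AnalyticAt.fun_comp (g := v) (by simpa using hva) analyticAt_snd))
    refine (eventually_eq_zero_of_imaginary_slices hG ?_).mono fun w hw => sub_eq_zero.1 hw
    filter_upwards [hgood, hE, hreal] with t h1 h2 h3
    set β := (F (Complex.I * t)).re
    have hFβ : F (Complex.I * t) = β := Complex.ext rfl (by simpa using h3)
    have h4 : IsFlatEigen P (fun z => h (Complex.I * t, z) - β • v z) (0 - β * 0) :=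
      h2.sub (hvE.const_smul β)
    have h5 : (fun z => h (Complex.I * t, z) - β • v z) =
        fun z => h (Complex.I * t, z) - F (Complex.I * t) * v z := by
      funext z
      rw [hFβ, Complex.real_smul]
    rw [h5] at h4
    refine h4.eventually_eq_zero_of_deriv_eq_zero hP (h1.1.sub (analyticAt_const.mul hva)) ?_
    rw [(h1.2.fun_sub (hvd.const_mul _)).deriv]
    ring

/-! ### Spiralling level curves -/

/-- In the coordinate `w` that linearizes `v`, the level sets of `P` are the spirals
`w₀ exp (i F(a - q) s)`, where `q` is the value of `P`. If `Im F(a - q)` did not vanish for small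
`q ≠ 0`, these spirals would run into the origin, where `P = 0 ≠ q`. -/
theorem deriv_im_eq_zero_of_tangent {P : ℂ → ℝ} (hP : IsIsolatedFlat P) {F v : ℂ → ℂ} {a : ℂ}
    (hF : AnalyticAt ℂ F a) (hv : AnalyticAt ℂ v 0) (hv0 : v 0 = 0)
    (hvI : deriv v 0 = Complex.I)
    (h : ∀ᶠ z in 𝓝 (0 : ℂ), fderiv ℝ P z (F (a - P z) * v z) = 0) : (deriv F a).im = 0 := by
  by_contra him
  obtain ⟨φ, hφ, hlin⟩ := exists_linearization hv hv0 (by rw [hvI]; exact Complex.I_ne_zero)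
  rw [hvI] at hlin
  have hshift := tendsto_shift hP a
  have hFim : ∀ᶠ z in 𝓝 (0 : ℂ), P z ≠ 0 → (F (a - P z)).im ≠ 0 := by
    have h1 : HasDerivAt (fun p : ℂ => F (a - p)) (-deriv F a) ((0 : ℝ) : ℂ) := by
      have h2 : HasDerivAt F (deriv F a) (a - ((0 : ℝ) : ℂ)) := by
        simpa using hF.differentiableAt.hasDerivAt
      simpa using h2.comp_const_sub a _
    have h2 := (Complex.imCLM.hasFDerivAt.comp_hasDerivAt (0 : ℝ) h1.comp_ofReal).eventually_ne
      (c := 0) (by simpa using him)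
    exact hP.tendsto.eventually (eventually_nhdsWithin_iff.1 h2)
  obtain ⟨L, t, ht, hL⟩ :=
    (hF.contDiffAt : ContDiffAt ℂ 1 F a).exists_lipschitzOnWith
  have hdP : ∀ᶠ z in 𝓝 (0 : ℂ), ‖fderiv ℝ P z‖ ≤ 1 := by
    obtain ⟨C, hC0, hC⟩ := (hP.fderiv_flat 1).exists_nonneg
    have h1 : Tendsto (fun z : ℂ => C * ‖z‖) (𝓝 0) (𝓝 (C * ‖(0 : ℂ)‖)) :=
      (continuous_const.mul continuous_norm).tendsto 0
    filter_upwards [hC.bound, h1.eventually_lt_const (by simp : C * ‖(0 : ℂ)‖ < 1)] with z h2 h3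
    simp only [pow_one, norm_norm] at h2
    linarith
  have hv1 : ∀ᶠ z in 𝓝 (0 : ℂ), ‖v z‖ < 1 :=
    hv.continuousAt.norm.eventually_lt_const (by simp [hv0])
  refine hP.not_eventually_eq_zero ?_
  rw [← hφ.map_nhds, eventually_map]
  obtain ⟨η, hη, hηb⟩ := Metric.eventually_nhds_iff_ball.1
    ((hlin.and hφ.holomorphic.eventually_analyticAt).and (hφ.tendsto.eventually
      ((h.and hFim).and ((hdP.and hv1).and (hP.differentiable.and (hshift.eventually ht))))))
  filter_upwards [Metric.ball_mem_nhds 0 hη] with w₀ hw₀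
  set q := P (φ w₀) with hq
  by_contra hq0
  set F₀ := F (a - q) with hF₀
  have hF₀im : F₀.im ≠ 0 := (hηb w₀ hw₀).2.1.2 hq0
  -- The sign is chosen such that the spiral approaches the origin in positive time.
  obtain ⟨σ, hσ1, hσ⟩ : ∃ σ : ℝ, |σ| ≤ 1 ∧ -(σ * F₀.im) < 0 := by
    refine ⟨SignType.sign F₀.im, ?_, ?_⟩
    · rcases lt_or_gt_of_ne hF₀im with h1 | h1 <;> simp [h1]
    · rw [sign_mul_self]
      simpa using hF₀im
  set μ : ℂ := σ * (F₀ * Complex.I) with hμ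
  have hμre : μ.re = -(σ * F₀.im) := by simp [hμ]
  have hmem : ∀ s : ℝ, 0 ≤ s → w₀ * Complex.exp (μ * s) ∈ Metric.ball (0 : ℂ) η := fun s hs => by
    rw [mem_ball_zero_iff] at *
    exact (norm_mul_exp_le (mul_nonpos_of_nonpos_of_nonneg (by rw [hμre]; exact hσ.le) hs)).trans_lt
      hw₀
  set z : ℝ → ℂ := fun s => φ (w₀ * Complex.exp (μ * s)) with hz
  have hlevel : ∀ T : ℝ, 0 ≤ T → P (z T) = q := fun T hT => by
    have hd : ∀ s ∈ Icc 0 T, HasDerivWithinAt (fun s => -(P (z s) - q) ^ 2)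
        (-(2 * (P (z s) - q) * fderiv ℝ P (z s) (σ * F₀ * v (z s)))) (Icc 0 T) s := fun s hs => by
      have h1 := hηb _ (hmem s hs.1)
      have h2 : HasDerivWithinAt z (σ * F₀ * v (z s)) (Icc 0 T) s :=
        hasDerivWithinAt_linearized (v := fun z => σ * F₀ * v z) h1.1.2.differentiableAt (by
          rw [← h1.1.1, hμ]
          ring)
      have h3 : HasDerivWithinAt (fun s => P (z s)) (fderiv ℝ P (z s) (σ * F₀ * v (z s)))
          (Icc 0 T) s := h1.2.2.2.1.hasFDerivAt.comp_hasDerivWithinAt s h2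
      exact ((h3.sub_const q).pow 2).neg.congr_deriv (by simp)
    have hmono := monotoneOn_mul_exp hd (A := fun s => -(2 * L) * s) (A' := fun _ => -(2 * L))
      (fun s _ => by simpa using ((hasDerivAt_id s).const_mul (-(2 * (L : ℝ)))).hasDerivWithinAt)
      (fun s hs => by
        have h1 := (hηb _ (hmem s hs.1)).2
        change (_ ∧ _) ∧ (_ ∧ _) ∧ _ ∧ _ at h1
        have h2 : fderiv ℝ P (z s) (σ * F₀ * v (z s)) =
            σ * fderiv ℝ P (z s) ((F₀ - F (a - P (z s))) * v (z s)) := by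
          rw [sub_mul, map_sub, h1.1.1, sub_zero, ← smul_eq_mul σ, ← map_smul, Complex.real_smul,
            mul_assoc]
        have h3 : ‖F₀ - F (a - P (z s))‖ ≤ L * |P (z s) - q| := by
          have h4 := hL.dist_le_mul _ (hηb w₀ hw₀).2.2.2.2 _ h1.2.2.2
          rw [dist_eq_norm, dist_eq_norm] at h4
          refine h4.trans (le_of_eq ?_)
          rw [sub_sub_sub_cancel_left, ← Complex.ofReal_sub, Complex.norm_real, Real.norm_eq_abs]
        have h5 : |fderiv ℝ P (z s) (σ * F₀ * v (z s))| ≤ L * |P (z s) - q| := by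
          rw [h2, abs_mul]
          have h6 : |fderiv ℝ P (z s) ((F₀ - F (a - P (z s))) * v (z s))| ≤
              1 * (L * |P (z s) - q| * 1) := by
            refine ((fderiv ℝ P (z s)).le_opNorm _).trans ?_
            rw [norm_mul]
            have h7 := h1.2.1.1
            have h8 := h1.2.1.2.le
            gcongr
          calc _ ≤ 1 * (1 * (L * |P (z s) - q| * 1)) := by gcongr
            _ = _ := by ring
        have h6 : (P (z s) - q) * fderiv ℝ P (z s) (σ * F₀ * v (z s)) ≤
            L * (P (z s) - q) ^ 2 := by
          refine (le_abs_self _).trans ?_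
          rw [abs_mul, ← sq_abs (P (z s) - q)]
          nlinarith [mul_le_mul_of_nonneg_left h5 (abs_nonneg (P (z s) - q))]
        linarith)
      (left_mem_Icc.2 hT) (right_mem_Icc.2 hT) hT
    have hz0 : P (z 0) = q := by simp [hz, hq]
    simp only [hz0, sub_self] at hmono
    have h1 : (P (z T) - q) ^ 2 ≤ 0 := by
      have h2 := Real.exp_pos (-(2 * L) * T)
      have h3 : 0 ≤ -(P (z T) - q) ^ 2 := by
        refine nonneg_of_mul_nonneg_left ?_ h2
        simpa using hmono
      linarith
    exact sub_eq_zero.1 (pow_eq_zero_iff two_ne_zero |>.1 (le_antisymm h1 (sq_nonneg _)))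
  have hlim : Tendsto (fun s : ℝ => w₀ * Complex.exp (μ * s)) atTop (𝓝 0) := by
    rw [tendsto_zero_iff_norm_tendsto_zero]
    have h1 : Tendsto (fun s : ℝ => ‖w₀‖ * Real.exp (μ.re * s)) atTop (𝓝 (‖w₀‖ * 0)) :=
      tendsto_const_nhds.mul (Real.tendsto_exp_atBot.comp
        (tendsto_id.const_mul_atTop_of_neg (by rw [hμre]; exact hσ)))
    rw [mul_zero] at h1
    refine h1.congr fun s => ?_
    rw [norm_mul, Complex.norm_exp]
    simp
  have hPlim : Tendsto (fun s => P (z s)) atTop (𝓝 0) :=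
    hP.tendsto.comp (hφ.tendsto.comp hlim)
  exact hq0 (tendsto_nhds_unique (hPlim.congr' ((eventually_ge_atTop 0).mono hlevel))
    tendsto_const_nhds).symm

/-! ### Rotational symmetry -/

theorem isRotationallySymmetric_of_fderiv_eq_zero {P : ℂ → ℝ} (hP : IsIsolatedFlat P)
    {φ v : ℂ → ℂ} (hφ : IsLocalBiholomorphism φ)
    (hlin : ∀ᶠ w in 𝓝 0, deriv φ w * (Complex.I * w) = v (φ w))
    (h : ∀ᶠ z in 𝓝 (0 : ℂ), fderiv ℝ P z (v z) = 0) : IsRotationallySymmetric (P ∘ φ) := by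
  obtain ⟨η, hη, hηb⟩ := Metric.eventually_nhds_iff_ball.1
    ((hlin.and hφ.holomorphic.eventually_analyticAt).and
      (hφ.tendsto.eventually (h.and hP.differentiable)))
  unfold IsRotationallySymmetric
  filter_upwards [Metric.ball_mem_nhds 0 hη] with w hw
  have hmem : ∀ t : ℝ, (‖w‖ : ℂ) * Complex.exp (Complex.I * t) ∈ Metric.ball (0 : ℂ) η := fun t => by
    rw [mem_ball_zero_iff] at *
    rw [norm_mul, mul_comm Complex.I, Complex.norm_exp_ofReal_mul_I]
    simpa using hw
  have hd : ∀ t : ℝ, HasDerivAt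
      (fun t : ℝ => P (φ ((‖w‖ : ℂ) * Complex.exp (Complex.I * t)))) 0 t := fun t => by
    have h1 := hηb _ (hmem t)
    have h2 : HasDerivAt (fun t : ℝ => φ ((‖w‖ : ℂ) * Complex.exp (Complex.I * t))) _ t :=
      hasDerivWithinAt_univ.1 (hasDerivWithinAt_linearized h1.1.2.differentiableAt h1.1.1)
    exact (h1.2.2.hasFDerivAt.comp_hasDerivAt t h2).congr_deriv h1.2.1
  have hc := is_const_of_deriv_eq_zero (fun t => (hd t).differentiableAt) (fun t => (hd t).deriv)
    w.arg 0
  simp only [Complex.ofReal_zero, mul_zero, Complex.exp_zero, mul_one] at hc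
  rwa [mul_comm Complex.I, Complex.norm_mul_exp_arg_mul_I] at hc

theorem hasForm_changeZ₂ {H : ℂ × ℂ → ℂ × ℂ} {φ : ℂ → ℂ} {β : ℝ} (hφ : IsLocalBiholomorphism φ)
    (h : ∀ᶠ w : ℂ × ℂ in 𝓝 0, H (changeZ₂ φ w) = (0, deriv φ w.2 * (Complex.I * β * w.2))) :
    HasForm H (changeZ₂ φ) (rotationField β) := by
  have hsnd : Tendsto (fun w : ℂ × ℂ => w.2) (𝓝 0) (𝓝 0) := continuous_snd.tendsto 0
  unfold HasForm
  filter_upwards [h, hsnd.eventually hφ.holomorphic.eventually_analyticAt] with w h1 h2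
  have h3 : HasFDerivAt (changeZ₂ φ) ((ContinuousLinearMap.fst ℂ ℂ ℂ).prod
      ((fderiv ℂ φ w.2).comp (ContinuousLinearMap.snd ℂ ℂ ℂ))) w :=
    hasFDerivAt_fst.prodMk (h2.differentiableAt.hasFDerivAt.comp w hasFDerivAt_snd)
  rw [h1, h3.fderiv]
  ext
  · simp [rotationField]
  · simp [rotationField, mul_comm]

end InfiniteTypeModel

open InfiniteTypeModel Filter

theorem theoremT3 (U : Set ℂ) (hU : IsOpen U) (h0 : (0 : ℂ) ∈ U)
    (P : ℂ → ℝ) (hP : ContDiffOn ℝ ∞ P U)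
    (hzero : connectedComponentIn {z | z ∈ U ∧ P z = 0} 0 = {0})
    (hinf : InfiniteTypeModel.VanishesToInfiniteOrder P)
    (H : ℂ × ℂ → ℂ × ℂ) (hH : InfiniteTypeModel.MemAut₀ P H) :
    (∀ᶠ z in 𝓝 (0 : ℂ × ℂ), H z = 0) ∨
      ∃ (β : ℝ) (φ : ℂ → ℂ), β ≠ 0 ∧ InfiniteTypeModel.IsLocalBiholomorphism φ ∧
        InfiniteTypeModel.HasForm H (InfiniteTypeModel.changeZ₂ φ)
          (InfiniteTypeModel.rotationField β) ∧
        InfiniteTypeModel.IsRotationallySymmetric (P ∘ φ) := by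
  have hPf := isIsolatedFlat_of_vanishesToInfiniteOrder hU h0 hP hzero hinf
  obtain ⟨hH1, hE⟩ := tangent_slices hPf hH
  have hh : AnalyticAt ℂ (fun w => (H w).2) 0 := analyticAt_snd.comp hH.holomorphic
  have hzeroH : (∀ᶠ w in 𝓝 0, (H w).2 = 0) → ∀ᶠ z in 𝓝 (0 : ℂ × ℂ), H z = 0 := fun h => by
    filter_upwards [hH1, h] with w h1 h2
    exact Prod.ext h1 h2
  rcases exists_factorization hPf hh hE with h | ⟨F, v, hF, hFreal, hv, hv0, hvI, hfac⟩
  · exact Or.inl (hzeroH h)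
  have htan : ∀ᶠ t : ℝ in 𝓝 0, ∀ᶠ z in 𝓝 (0 : ℂ),
      fderiv ℝ P z (F (Complex.I * t - P z) * v z) = 0 := by
    filter_upwards [hH.tangent.eventually_eq hPf,
      tendsto_I_mul_prodMk.eventually (hH1.and hfac).eventually_nhds] with t h1 h2
    have ht : Tendsto (fun z : ℂ => (Complex.I * t - (P z : ℂ), z)) (𝓝 0)
        (𝓝 (Complex.I * t, 0)) := (tendsto_shift hPf _).prodMk_nhds tendsto_id
    filter_upwards [h1, ht.eventually h2] with z h3 h4
    rw [h4.1, h4.2, Complex.zero_re, zero_add] at h3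
    exact h3
  have hF' : ∀ᶠ t : ℝ in 𝓝 0, deriv F (Complex.I * t) = 0 := by
    filter_upwards [htan, hFreal.eventually_nhds,
      tendsto_I_mul.eventually hF.eventually_analyticAt] with t h1 h2 h3
    refine Complex.ext ?_ (deriv_im_eq_zero_of_tangent hPf h3 hv hv0 hvI h1)
    -- `F` is real on the imaginary axis, so that its derivative there is imaginary.
    have h4 := Complex.imCLM.hasFDerivAt.comp_hasDerivAt t
      (hasDerivAt_comp_I_mul h3.differentiableAt)
    have h5 : HasDerivAt (fun _ : ℝ => (0 : ℝ)) _ t :=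
      h4.congr_of_eventuallyEq (h2.mono fun s hs => hs.symm)
    simpa using h5.unique (hasDerivAt_const _ _)
  have hFc := eventually_eq_of_deriv_eq_zero hF hF'
  set β := (F 0).re
  have hFβ : F 0 = β := Complex.ext rfl (by simpa using hFreal.self_of_nhds)
  have hfst : Tendsto (fun w : ℂ × ℂ => w.1) (𝓝 0) (𝓝 0) := continuous_fst.tendsto 0
  have hHβ : ∀ᶠ w : ℂ × ℂ in 𝓝 0, H w = (0, β * v w.2) := by
    filter_upwards [hH1, hfac, hfst.eventually hFc] with w h1 h2 h3
    exact Prod.ext h1 (by rw [h2, h3, hFβ])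
  by_cases hβ : β = 0
  · left
    filter_upwards [hHβ] with w hw
    rw [hw, hβ, Complex.ofReal_zero, zero_mul, Prod.mk_zero_zero]
  obtain ⟨φ, hφ, hlin⟩ := exists_linearization hv hv0 (by rw [hvI]; exact Complex.I_ne_zero)
  rw [hvI] at hlin
  refine Or.inr ⟨β, φ, hβ, hφ, hasForm_changeZ₂ hφ ?_,
    isRotationallySymmetric_of_fderiv_eq_zero hPf hφ hlin ?_⟩
  · have hsnd : Tendsto (fun w : ℂ × ℂ => w.2) (𝓝 0) (𝓝 0) := continuous_snd.tendsto 0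
    have hΦ : Tendsto (changeZ₂ φ) (𝓝 0) (𝓝 0) := by
      have := hfst.prodMk_nhds (hφ.tendsto.comp hsnd)
      rwa [Prod.mk_zero_zero] at this
    filter_upwards [hΦ.eventually hHβ, hsnd.eventually hlin] with w h1 h2
    rw [h1]
    refine Prod.ext rfl ?_
    change β * v (φ w.2) = _
    rw [← h2]
    ring
  · have hs : Tendsto (fun z : ℂ => Complex.I * ((0 : ℝ) : ℂ) - (P z : ℂ)) (𝓝 0) (𝓝 0) := by
      simpa using tendsto_shift hPf (Complex.I * ((0 : ℝ) : ℂ))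
    filter_upwards [htan.self_of_nhds, hs.eventually hFc] with z h1 h2
    rw [h2, hFβ, ← Complex.real_smul, map_smul, smul_eq_mul] at h1
    exact (mul_eq_zero.1 h1).resolve_left hβ
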